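/- Let $d\ge 1$ and let $a:\mathbb{R}^d\to[0,\infty)$ be measurable with $a^{(0)}:=\int_{\mathbb{R}^d}a(x)\,dx>0$ and $a(y)\le C(1+|y|)^{-\alpha}$ for all $y\in\mathbb{R}^d$, for some constants $C$ and $\alpha>2d$. Let $\Gamma$ be the space of locally finite subsets (configurations) of $\mathbb{R}^d$, with the vague topology, i.e. the coarsest topology making $\gamma\mapsto\langle f,\gamma\rangle:=\sum_{x\in\gamma}f(x)$ continuous for every $f\in C_c(\mathbb{R}^d)$, and its Borel $\sigma$-algebra. For a locally integrable $z\ge 0$, the Poisson measure $\pi_z$ is the probability measure on $\Gamma$ with $$\int_\Gamma e^{\langle\varphi,\gamma\rangle}\,\pi_z(d\gamma)=\exp\Big(\int_{\mathbb{R}^d}\big(e^{\varphi(x)}-1\big)z(x)\,dx\Big)\qquad\text{for all }\varphi\in C_c^\infty(\mathbb{R}^d).$$ In the free Kawasaki dynamics the particles of the initial configuration move independently, each as the jump process $X_t=Y_{Z_t}$, where $(Y_k)_{k\ge0}$ is the Markov chain on $\mathbb{R}^d$ with transition density $(x,y)\mapsto a(x-y)/a^{(0)}$, started at the initial position of the particle,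 and $(Z_t)_{t\ge0}$ is a Poisson process with parameter $a^{(0)}$ independent of $(Y_k)$. Let $\mathbf{P}_t(\gamma,\cdot)$ be the law of the configuration at time $t$ when the initial configuration is $\gamma$, and let $P_{\mu,t}:=\int\mathbf{P}_t(\gamma,\cdot)\,\mu(d\gamma)$ be the one-dimensional distribution at time $t$ of the dynamics with initial distribution $\mu$. Let $z:\mathbb{R}^d\to[0,\infty)$ be a bounded measurable function whose Fourier transform $\hat z$, in the sense of tempered distributions, is a signed measure (complex-valued and not necessarily of finite total variation): all Schwartz functions are integrable with respect to $|\hat z|$, and $\int\varphi(k)\,\hat z(dk)=\int\hat\varphi(x)\,z(x)\,dx$ for every Schwartz function $\varphi$. Then $z$ has an arithmetic mean, i.e. the limit $$\mathrm{mean}(z):=\lim_{R\to\infty}\frac{1}{\mathrm{vol}(B(R))}\int_{B(R)}z(x)\,dx$$ over the closed balls $B(R)$ of radius $R$ centred at $0$ exists. Moreover, $P_{\pi_z,t}$ is a probability measure for every $t\ge0$, and $P_{\pi_z,t}$ converges weakly, as $t\to\infty$, to $\pi_{\mathrm{mean}(z)}$, the Poisson measure whose intensity is the constant $\mathrm{mean}(z)$.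 -/

import Mathlib

open MeasureTheory ProbabilityTheory Filter Topology
open scoped NNReal ENNReal ContDiff SchwartzMap FourierTransform CompactlySupported

noncomputable section

namespace FreeKawasaki

/-- The Euclidean space `ℝ^d`. -/
abbrev E (d : ℕ) : Type := EuclideanSpace ℝ (Fin d)

/-! ### The configuration space -/

/-- The configuration space `Γ` over `ℝ^d`: the locally finite subsets of `ℝ^d`. -/
@[ext]
structure Configuration (d : ℕ) where
  carrier : Set (E d)
  locallyFinite : ∀ K : Set (E d), IsCompact K → (carrier ∩ K).Finite

/-- The pairing `⟨φ, γ⟩ = ∑_{x ∈ γ} φ(x)` (a finite sum when `φ` has compact support). -/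
def pairing {d : ℕ} (φ : E d → ℝ) (γ : Configuration d) : ℝ :=
  ∑' x : γ.carrier, φ x

/-- The vague topology on `Γ`: the coarsest topology for which all maps `γ ↦ ⟨f, γ⟩`,
`f ∈ C_c(ℝ^d)`, are continuous. -/
instance (d : ℕ) : TopologicalSpace (Configuration d) :=
  TopologicalSpace.induced (fun (γ : Configuration d) (f : C_c(E d, ℝ)) => pairing f γ)
    inferInstance

/-- The Borel `σ`-algebra of the vague topology. -/
instance (d : ℕ) : MeasurableSpace (Configuration d) := borel _

instance (d : ℕ) : BorelSpace (Configuration d) := ⟨rfl⟩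

open Classical in
/-- A subset of `ℝ^d` regarded as a configuration; the empty configuration if the set is not
locally finite. -/
def Configuration.ofSet {d : ℕ} (s : Set (E d)) : Configuration d :=
  if h : ∀ K : Set (E d), IsCompact K → (s ∩ K).Finite then ⟨s, h⟩
  else ⟨∅, fun K _ => by simp⟩

/-! ### Poisson measures -/

/-- `π` is the Poisson measure on `Γ` with intensity `z`: it is a probability measure, and
`∫ e^{⟨φ, γ⟩} π(dγ) = exp (∫ (e^{φ(x)} - 1) z(x) dx)` for all `φ ∈ C_c^∞(ℝ^d)`. -/
def IsPoissonMeasure {d : ℕ} (z : E d → ℝ) (π : Measure (Configuration d)) : Prop :=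
  IsProbabilityMeasure π ∧
    ∀ φ : E d → ℝ, ContDiff ℝ ∞ φ → HasCompactSupport φ →
      ∫ γ, Real.exp (pairing φ γ) ∂π = Real.exp (∫ x, (Real.exp (φ x) - 1) * z x)

open Classical in
/-- The Poisson measure `π_z`, that is, the probability measure on `Γ` with the above Laplace
transform (the zero measure if there is none). -/
def poissonMeasure {d : ℕ} (z : E d → ℝ) : Measure (Configuration d) :=
  if h : ∃ π : Measure (Configuration d), IsPoissonMeasure z π then h.choose else 0

/-! ### The one-particle jump process -/

/-- The total jump rate `a⁽⁰⁾ = ∫ a(x) dx`. -/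
def totalRate {d : ℕ} (a : E d → ℝ) : ℝ := ∫ x, a x

/-- The law on `ℝ^d` with density `a / a⁽⁰⁾`. -/
def jumpLaw {d : ℕ} (a : E d → ℝ) : Measure (E d) :=
  volume.withDensity fun y => ENNReal.ofReal (a y / totalRate a)

/-- The randomness of one particle: its successive jumps and its successive waiting times. -/
abbrev ParticleSpace (d : ℕ) : Type := (ℕ → E d) × (ℕ → ℝ)

/-- Independent jumps with density `a / a⁽⁰⁾`, and, independently of them, independent
exponential waiting times with parameter `a⁽⁰⁾`. -/
def particleLaw {d : ℕ} (a : E d → ℝ) : Measure (ParticleSpace d) :=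
  (Measure.infinitePi fun _ : ℕ => jumpLaw a).prod
    (Measure.infinitePi fun _ : ℕ => expMeasure (totalRate a))

/-- The Markov chain `Y_k` started at `x`, with transition density
`(x, y) ↦ a (x - y) / a⁽⁰⁾`. -/
def chain {d : ℕ} (x : E d) (w : ParticleSpace d) (k : ℕ) : E d :=
  x - ∑ i ∈ Finset.range k, w.1 i

/-- The Poisson process `Z_t` with parameter `a⁽⁰⁾`: the number of jumps up to time `t`, which is
the least `n` such that the `(n+1)`-st jump takes place after time `t`. -/
def jumpCount {d : ℕ} (w : ParticleSpace d) (t : ℝ≥0) : ℕ :=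
  sInf {n : ℕ | (t : ℝ) < ∑ i ∈ Finset.range (n + 1), w.2 i}

/-- The one-particle jump process `X_t = Y_{Z_t}` started at `x`. -/
def position {d : ℕ} (x : E d) (w : ParticleSpace d) (t : ℝ≥0) : E d :=
  chain x w (jumpCount w t)

/-! ### The free Kawasaki dynamics -/

/-- The law of the independent randomness of all the particles of the initial
configuration `γ`. -/
def systemLaw {d : ℕ} (a : E d → ℝ) (γ : Configuration d) :
    Measure (γ.carrier → ParticleSpace d) :=
  Measure.infinitePi fun _ : γ.carrier => particleLaw a

/-- The state at time `t` of the free Kawasaki dynamics started at `γ`: each particle of `γ` has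
moved independently of the others according to the one-particle jump process. -/
def state {d : ℕ} (γ : Configuration d) (t : ℝ≥0) (w : γ.carrier → ParticleSpace d) :
    Configuration d :=
  Configuration.ofSet (Set.range fun x : γ.carrier => position (x : E d) (w x) t)

/-- The transition kernel `𝐏_t(γ, ·)` of the free Kawasaki dynamics. -/
def transition {d : ℕ} (a : E d → ℝ) (t : ℝ≥0) (γ : Configuration d) :
    Measure (Configuration d) :=
  (systemLaw a γ).map (state γ t)

/-- The one-dimensional distribution at time `t` of the free Kawasaki dynamics with initial
distribution `μ`, that is, `∫ 𝐏_t(γ, ·) μ(dγ)`. -/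
def oneDimDistribution {d : ℕ} (a : E d → ℝ) (μ : Measure (Configuration d)) (t : ℝ≥0) :
    Measure (Configuration d) :=
  μ.bind (transition a t)

/-! ### Arithmetic mean and Fourier transform -/

/-- `z` has arithmetic mean `m`: `vol(B(R))⁻¹ ∫_{B(R)} z(x) dx → m` as `R → ∞`. -/
def HasArithmeticMean {d : ℕ} (z : E d → ℝ) (m : ℝ) : Prop :=
  Tendsto (fun R : ℝ => ⨍ x in Metric.closedBall (0 : E d) R, z x) atTop (𝓝 m)

/-- The Fourier transform of `z`, in the sense of tempered distributions, is a (complex-valued,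
not necessarily finite) signed measure `ẑ`. The measure is written in polar form `ẑ = h ν`, where
`ν = |ẑ|` is its total variation and `|h| = 1`; Schwartz functions are `ẑ`-integrable and
`∫ φ(k) ẑ(dk) = ∫ φ̂(x) z(x) dx` for all of them. The existence of `ẑ` does not depend on the
normalization of the Fourier transform; here `φ̂(x) = ∫ e^{-2πi⟨k, x⟩} φ(k) dk`. -/
def FourierTransformIsMeasure {d : ℕ} (z : E d → ℝ) : Prop :=
  ∃ (ν : Measure (E d)) (h : E d → ℂ), Measurable h ∧ (∀ k, ‖h k‖ = 1) ∧
    ∀ φ : 𝓢(E d, ℂ), Integrable (fun k => φ k) ν ∧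
      ∫ k, φ k * h k ∂ν = ∫ x, (𝓕 φ) x * (z x : ℂ)

end FreeKawasaki

end

/-! Everything is read off from Laplace functionals. Let `κ_t` be the law of the displacement of one
particle up to time `t`. Since the particles move independently, `𝐏_t` turns `e^{-⟨f, ·⟩}` into the
product over the particles `x` of `(κ_t * e^{-f})(x)`, and the Laplace transform of `π_z` turns this
product into `exp (-∫ (κ_t * g)(x) z(x) dx)` with `g = 1 - e^{-f}`. The claim is thus that `∫ (κ_t *
g) z → mean(z) ∫ g` for smooth `g` with compact support.

On the Fourier side this integral is `∫ (𝓕⁻ g)(k) κ̂_t(2πk) ẑ(dk)`, where `κ̂_t` is the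
characteristic function (`integral_smear_eq_integral_charFun`). Conditionally on the waiting times,
`κ̂_t(k)` is `q^{Z_t}`, where `q` is the characteristic function of a single jump. For `k ≠ 0` one
has `|q| < 1`, because the jump law has a density, and `Z_t → ∞` almost surely, so `κ̂_t(k) → 0`.
Dominated convergence leaves only the atom of `ẑ` at the origin, and the limit is `ẑ({0}) ∫ g`. The
same argument applies to any probability measures whose characteristic functions vanish in the limit
off the origin (`FourierTransformIsMeasure.exists_tendsto`); for uniform laws on balls, which
qualify by the Riemann–Lebesgue lemma, it identifies `ẑ({0})` as the arithmetic mean.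

Three foundations are needed. The vague topology is induced by a map into a countable power of `[0,
1]`, so that Stone–Weierstrass on this compact cube makes Laplace functionals decide equality,
measurability and weak convergence. Poisson measures are constructed shell by shell. Finally, for
`π_z`-almost every initial configuration the moved particles almost surely stay locally finite, by
Borel–Cantelli, and never coincide, since the displacement has no atom off the origin; the sets that
define the dynamics therefore lose no particle. -/

namespace FreeKawasaki

variable {d : ℕ}

/-! ### Test functions and pairings -/

/-- Test functions: nonnegative smooth functions with compact support. -/
structure IsTest (f : E d → ℝ) : Prop where
  smooth : ContDiff ℝ ∞ f
  compact : HasCompactSupport f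
  nonneg : ∀ x, 0 ≤ f x

lemma IsTest.continuous {f : E d → ℝ} (hf : IsTest f) : Continuous f := hf.smooth.continuous

lemma IsTest.add {f g : E d → ℝ} (hf : IsTest f) (hg : IsTest g) : IsTest (f + g) :=
  ⟨hf.smooth.add hg.smooth, hf.compact.add hg.compact,
    fun x => add_nonneg (hf.nonneg x) (hg.nonneg x)⟩

lemma isTest_zero : IsTest (0 : E d → ℝ) :=
  ⟨contDiff_const, HasCompactSupport.zero, fun _ => le_rfl⟩

/-- Smooth cutoff functions, equal to one on the ball of radius `n + 1`. -/
noncomputable def cutoff (d n : ℕ) : ContDiffBump (0 : E d) :=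
  ⟨n + 1, n + 2, by positivity, by linarith⟩

lemma isTest_cutoff (n : ℕ) : IsTest (cutoff d n) :=
  ⟨(cutoff d n).contDiff, (cutoff d n).hasCompactSupport, fun _ => (cutoff d n).nonneg⟩

lemma cutoff_eq_one {n : ℕ} {x : E d} (hx : ‖x‖ ≤ n + 1) : cutoff d n x = 1 :=
  (cutoff d n).one_of_mem_closedBall (by simpa [cutoff] using hx)

lemma exists_norm_lt_of_ne_zero {f : E d → ℝ} (hf : HasCompactSupport f) :
    ∃ n : ℕ, ∀ x, f x ≠ 0 → ‖x‖ < n := by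
  obtain ⟨R, hR⟩ := hf.isCompact.isBounded.exists_norm_le
  obtain ⟨n, hn⟩ := exists_nat_gt R
  exact ⟨n, fun x hx => (hR x (subset_tsupport f hx)).trans_lt hn⟩

lemma finite_support_carrier {f : E d → ℝ} (hf : HasCompactSupport f) (γ : Configuration d) :
    (Function.support fun x : γ.carrier => f x).Finite := by
  have h := γ.locallyFinite (tsupport f) hf.isCompact
  refine Set.Finite.of_finite_image (h.subset ?_) Subtype.val_injective.injOn
  rintro _ ⟨x, hx, rfl⟩
  exact ⟨x.2, subset_tsupport f hx⟩

lemma summable_carrier {f : E d → ℝ} (hf : HasCompactSupport f) (γ : Configuration d) :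
    Summable fun x : γ.carrier => f x :=
  summable_of_hasFiniteSupport (finite_support_carrier hf γ)

lemma pairing_add {f g : E d → ℝ} (hf : HasCompactSupport f) (hg : HasCompactSupport g)
    (γ : Configuration d) : pairing (f + g) γ = pairing f γ + pairing g γ :=
  (summable_carrier hf γ).tsum_add (summable_carrier hg γ)

lemma pairing_zero (γ : Configuration d) : pairing 0 γ = 0 := by
  simp [pairing]

lemma pairing_nonneg {f : E d → ℝ} (hf : ∀ x, 0 ≤ f x) (γ : Configuration d) :
    0 ≤ pairing f γ := tsum_nonneg fun x => hf x

lemma abs_pairing_sub_le {f g χ : E d → ℝ} (hf : HasCompactSupport f) (hg : HasCompactSupport g)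
    (hχ : HasCompactSupport χ) {ε : ℝ} (h : ∀ x, |f x - g x| ≤ ε * χ x) (γ : Configuration d) :
    |pairing f γ - pairing g γ| ≤ ε * pairing χ γ := by
  have hf' := summable_carrier hf γ
  have hg' := summable_carrier hg γ
  have hχ' := (summable_carrier hχ γ).mul_left ε
  unfold pairing
  rw [← hf'.tsum_sub hg', ← tsum_mul_left, ← Real.norm_eq_abs]
  exact tsum_of_norm_bounded hχ'.hasSum fun x => h x

lemma continuous_pairing {f : E d → ℝ} (hf : Continuous f) (hc : HasCompactSupport f) :
    Continuous (pairing f) := by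
  have h : Continuous fun (γ : Configuration d) (f : C_c(E d, ℝ)) => pairing f γ :=
    continuous_induced_dom
  exact (continuous_apply (⟨⟨f, hf⟩, hc⟩ : C_c(E d, ℝ))).comp h

/-- A smooth partition of unity glues local constants. The three requirements on the value at a
point (sign, closeness to `f`, vanishing where `f` vanishes) are convex, and near every point `x`
the constant `f x` meets them. The third one keeps the support from growing. -/
lemma exists_isTest_approx {f : E d → ℝ} (hf : Continuous f) (hc : HasCompactSupport f)
    (h0 : ∀ x, 0 ≤ f x) {ε : ℝ} (hε : 0 < ε) :
    ∃ g : E d → ℝ, IsTest g ∧ (∀ x, |g x - f x| ≤ ε) ∧ ∀ x, f x = 0 → g x = 0 := by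
  obtain ⟨g, hg⟩ := exists_contMDiffMap_forall_mem_convex_of_local_const (n := (⊤ : ℕ∞))
    (modelWithCornersSelf ℝ (E d)) (F := ℝ)
    (t := fun x => Set.Ici 0 ∩ Set.Icc (f x - ε) (f x + ε) ∩ {c | f x = 0 → c = 0})
    (fun x => by
      refine ((convex_Ici 0).inter (convex_Icc _ _)).inter ?_
      by_cases hx : f x = 0
      · simp only [hx, true_imp_iff]
        exact convex_singleton (0 : ℝ)
      · simp only [hx, false_imp_iff]
        exact convex_univ)
    (fun x => by
      refine ⟨f x, ?_⟩
      have h1 : ∀ᶠ y in 𝓝 x, f y ∈ Set.Icc (f x - ε) (f x + ε) :=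
        hf.continuousAt (Icc_mem_nhds (by linarith) (by linarith))
      have h2 : ∀ᶠ y in 𝓝 x, f y = 0 → f x = 0 := by
        by_cases hx : f x = 0
        · simp [hx]
        · filter_upwards [hf.continuousAt.eventually_ne hx] with y hy hy'
          exact absurd hy' hy
      filter_upwards [h1, h2] with y hy1 hy2
      exact ⟨⟨h0 x, by linarith [hy1.2], by linarith [hy1.1]⟩, hy2⟩)
  refine ⟨g, ⟨g.contMDiff.contDiff, ?_, fun x => (hg x).1.1⟩, fun x => ?_, fun x => (hg x).2⟩
  · refine hc.mono fun x hx hfx => hx ((hg x).2 hfx)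
  · have := (hg x).1.2
    rw [abs_le]
    constructor <;> linarith [this.1, this.2]

/-! ### A countable family of test functions inducing the vague topology -/

/-- Subspaces of `C(E d, ℝ)` with the compact-open topology are separable. Closeness on the closed
ball of radius `n` is closeness everywhere, as the functions vanish outside it. -/
lemma exists_countable_dense_isTest (d n : ℕ) :
    ∃ D : Set (E d → ℝ), D.Countable ∧ (∀ f ∈ D, IsTest f ∧ ∀ x, f x ≠ 0 → ‖x‖ < n) ∧
      ∀ f : E d → ℝ, IsTest f → (∀ x, f x ≠ 0 → ‖x‖ < n) → ∀ ε > 0,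
        ∃ g ∈ D, ∀ x, |f x - g x| ≤ ε := by
  let S : Set C(E d, ℝ) := {f | IsTest f ∧ ∀ x, f x ≠ 0 → ‖x‖ < n}
  obtain ⟨D, hDc, hD⟩ := TopologicalSpace.exists_countable_dense S
  refine ⟨(fun f : S => (f.1 : E d → ℝ)) '' D, hDc.image _, ?_, fun f hf hfn ε hε => ?_⟩
  · rintro _ ⟨f, -, rfl⟩
    exact f.2
  let F : C(E d, ℝ) := ⟨f, hf.continuous⟩
  have hopen : IsOpen {g : S | Set.MapsTo (F - g.1) (Metric.closedBall 0 n) (Metric.ball 0 ε)} :=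
    (ContinuousMap.isOpen_setOfPred_mapsTo (isCompact_closedBall 0 _) Metric.isOpen_ball).preimage
      (continuous_const.sub continuous_subtype_val)
  obtain ⟨g, hg, hgD⟩ := hD.inter_open_nonempty _ hopen
    ⟨⟨F, hf, hfn⟩, fun x _ => by simpa using hε⟩
  refine ⟨g.1, ⟨g, hgD, rfl⟩, fun x => ?_⟩
  by_cases hx : ‖x‖ ≤ n
  · have := hg (show x ∈ Metric.closedBall (0 : E d) n by simpa using hx)
    simp only [ContinuousMap.coe_sub, Pi.sub_apply, mem_ball_zero_iff, Real.norm_eq_abs] at this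
    exact this.le
  · have h1 : f x = 0 := by
      by_contra h
      exact hx (hfn x h).le
    have h2 : g.1 x = 0 := by
      by_contra h
      exact hx (g.2.2 x h).le
    rw [h1, h2]
    simpa using hε.le

/-- The coordinate `e^{-⟨f, γ⟩}` in the unit interval; for test functions, the truncation at `1`
is void. -/
noncomputable def laplaceCoord (f : E d → ℝ) (γ : Configuration d) : unitInterval :=
  ⟨min 1 (Real.exp (-pairing f γ)), le_min zero_le_one (Real.exp_pos _).le, min_le_left _ _⟩

lemma coe_laplaceCoord {f : E d → ℝ} (hf : ∀ x, 0 ≤ f x) (γ : Configuration d) :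
    (laplaceCoord f γ : ℝ) = Real.exp (-pairing f γ) :=
  min_eq_right (Real.exp_le_one_iff.2 (neg_nonpos.2 (pairing_nonneg hf γ)))

lemma continuous_laplaceCoord {f : E d → ℝ} (hf : IsTest f) : Continuous (laplaceCoord f) :=
  (continuous_const.min (continuous_pairing hf.continuous hf.compact).neg.rexp).subtype_mk _

/-- If `|f - g| ≤ δ χ` with a cutoff `χ`, then `|⟨f, γ⟩ - ⟨g, γ⟩| ≤ δ ⟨χ, γ⟩`. The cutoffs belong to
the family, so `⟨χ, ·⟩` is continuous, hence locally bounded, for the induced topology. Pairings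
with arbitrary `f ∈ C_c` are then locally uniform limits of pairings with members of the family. -/
theorem exists_countable_isInducing (d : ℕ) :
    ∃ D : Set (E d → ℝ), D.Countable ∧ (∀ f ∈ D, IsTest f) ∧
      IsInducing fun (γ : Configuration d) (f : D) => laplaceCoord f.1 γ := by
  choose A hAc hA hAd using exists_countable_dense_isTest d
  let D : Set (E d → ℝ) := (⋃ n, A n) ∪ Set.range fun n => (cutoff d n : E d → ℝ)
  have hD : ∀ f ∈ D, IsTest f := by
    rintro f (hf | ⟨n, rfl⟩)
    · obtain ⟨n, hn⟩ := Set.mem_iUnion.1 hf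
      exact (hA n f hn).1
    · exact isTest_cutoff n
  refine ⟨D, (Set.countable_iUnion hAc).union (Set.countable_range _), hD, ⟨?_⟩⟩
  apply le_antisymm
  · rw [← continuous_iff_le_induced]
    exact continuous_pi fun f => continuous_laplaceCoord (hD f f.2)
  let τ : TopologicalSpace (Configuration d) :=
    TopologicalSpace.induced (fun (γ : Configuration d) (f : D) => laplaceCoord f.1 γ) inferInstance
  have hcoord : ∀ f ∈ D, @Continuous _ _ τ _ (pairing f) := by
    intro f hf
    have h1 : @Continuous _ _ τ _ fun (γ : Configuration d) (f : D) => laplaceCoord f.1 γ :=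
      continuous_induced_dom
    have h2 : @Continuous _ _ τ _ fun γ : Configuration d => Real.exp (-pairing f γ) := by
      have h3 := continuous_subtype_val.comp ((continuous_apply (⟨f, hf⟩ : D)).comp h1)
      refine @Continuous.congr _ _ τ _ _ _ h3 fun γ => ?_
      exact coe_laplaceCoord (hD f hf).nonneg γ
    have h4 : @Continuous _ _ τ _ fun γ : Configuration d => -Real.log (Real.exp (-pairing f γ)) :=
      (h2.log fun _ => (Real.exp_pos _).ne').neg
    simpa using h4
  have hpos : ∀ f : E d → ℝ, Continuous f → HasCompactSupport f → (∀ x, 0 ≤ f x) →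
      @Continuous _ _ τ _ (pairing f) := by
    intro f hf hc h0
    obtain ⟨n, hn⟩ := exists_norm_lt_of_ne_zero hc
    have hχ := hcoord _ (Or.inr ⟨n, rfl⟩)
    refine continuous_of_locally_uniform_approx_of_continuousAt fun γ u hu => ?_
    obtain ⟨ε, hε, hεu⟩ := Metric.mem_uniformity_dist.1 hu
    have hC : 0 < pairing (cutoff d n) γ + 1 :=
      add_pos_of_nonneg_of_pos (pairing_nonneg (fun x => (cutoff d n).nonneg) γ) one_pos
    let δ : ℝ := ε / (2 * (pairing (cutoff d n) γ + 1))
    have hδ : 0 < δ := by positivity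
    obtain ⟨g₁, hg₁, hfg₁, hg₁0⟩ := exists_isTest_approx hf hc h0 (half_pos hδ)
    obtain ⟨g, hg, hg₁g⟩ := hAd n g₁ hg₁ (fun x hx => hn x fun h => hx (hg₁0 x h)) _ (half_pos hδ)
    have hgD : g ∈ D := Or.inl (Set.mem_iUnion.2 ⟨n, hg⟩)
    have hfg : ∀ x, |f x - g x| ≤ δ * cutoff d n x := by
      intro x
      by_cases hx : ‖x‖ < n
      · rw [cutoff_eq_one (by linarith), mul_one]
        calc |f x - g x| ≤ |f x - g₁ x| + |g₁ x - g x| := abs_sub_le _ _ _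
          _ ≤ δ / 2 + δ / 2 := add_le_add (by rw [abs_sub_comm]; exact hfg₁ x) (hg₁g x)
          _ = δ := add_halves δ
      · have h1 : f x = 0 := by
          by_contra h
          exact hx (hn x h)
        have h2 : g x = 0 := by
          by_contra h
          exact hx ((hA n g hg).2 x h)
        rw [h1, h2, sub_zero, abs_zero]
        exact mul_nonneg hδ.le (cutoff d n).nonneg
    refine ⟨{γ' | pairing (cutoff d n) γ' < pairing (cutoff d n) γ + 1},
      (isOpen_Iio.preimage hχ).mem_nhds (lt_add_one (pairing (cutoff d n) γ)), pairing g,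
      (hcoord g hgD).continuousAt, fun γ' hγ' => hεu ?_⟩
    rw [Real.dist_eq]
    calc |pairing f γ' - pairing g γ'| ≤ δ * pairing (cutoff d n) γ' :=
          abs_pairing_sub_le hc (hD g hgD).compact (cutoff d n).hasCompactSupport hfg γ'
      _ ≤ δ * (pairing (cutoff d n) γ + 1) := by
          exact mul_le_mul_of_nonneg_left (le_of_lt hγ') hδ.le
      _ = ε / 2 := by simp only [δ]; field_simp
      _ < ε := half_lt_self hε
  refine continuous_iff_le_induced.1 ?_
  refine continuous_pi fun f => ?_
  have hc₁ : HasCompactSupport fun x => max (f x) 0 :=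
    f.hasCompactSupport.mono fun x hx h => hx (by simp [h])
  have hc₂ : HasCompactSupport fun x => max (-f x) 0 :=
    f.hasCompactSupport.mono fun x hx h => hx (by simp [h])
  have h1 := hpos _ (f.continuous.max continuous_const) hc₁ fun x => le_max_right _ _
  have h2 := hpos _ (f.continuous.neg.max continuous_const) hc₂ fun x => le_max_right _ _
  have h3 := h1.sub h2
  refine @Continuous.congr _ _ τ _ _ _ h3 fun γ => ?_
  refine ((summable_carrier hc₁ γ).tsum_sub (summable_carrier hc₂ γ)).symm.trans ?_
  refine tsum_congr fun x => ?_
  rcases le_total (f x) 0 with h | h <;> simp [h]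

/-- A countable family of test functions that induces the vague topology. -/
noncomputable def testFamily (d : ℕ) : Set (E d → ℝ) := (exists_countable_isInducing d).choose

lemma isTest_of_mem_testFamily {f : E d → ℝ} (hf : f ∈ testFamily d) : IsTest f :=
  (exists_countable_isInducing d).choose_spec.2.1 f hf

instance countable_testFamily (d : ℕ) : Countable (testFamily d) :=
  (exists_countable_isInducing d).choose_spec.1.to_subtype

/-- The map `γ ↦ (e^{-⟨f, γ⟩})_f` into a countable power of the unit interval. -/
noncomputable def laplaceMap (γ : Configuration d) (f : testFamily d) : unitInterval :=
  laplaceCoord f.1 γ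

lemma isInducing_laplaceMap : IsInducing (laplaceMap (d := d)) :=
  (exists_countable_isInducing d).choose_spec.2.2

lemma continuous_laplaceMap : Continuous (laplaceMap (d := d)) := isInducing_laplaceMap.continuous

/-- The test family is countable, so the Borel `σ`-algebra of the cube is the product `σ`-algebra.
-/
lemma measurableSpace_configuration_eq :
    instMeasurableSpaceConfiguration d =
      MeasurableSpace.comap (laplaceMap (d := d)) inferInstance := by
  rw [BorelSpace.measurable_eq (α := Configuration d), isInducing_laplaceMap.eq_induced, borel_comap,
    ← BorelSpace.measurable_eq]

/-! ### Stone–Weierstrass for Laplace functionals -/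

/-- The functions that become some `e^{-⟨f, ·⟩}` along `laplaceMap` form a monoid, because pairings
are additive in `f`. The algebra they generate is therefore their linear span; it contains the
coordinates, so it separates points and is dense by Stone–Weierstrass. Nothing is required of `F`
off the image of `laplaceMap`. -/
theorem laplaceMap_induction {P : C(testFamily d → unitInterval, ℝ) → Prop}
    (closed : IsClosed {F | P F}) (add : ∀ F G, P F → P G → P (F + G))
    (smul : ∀ (c : ℝ) F, P F → P (c • F))
    (test : ∀ f : E d → ℝ, IsTest f → ∀ F : C(testFamily d → unitInterval, ℝ),
      (∀ γ, F (laplaceMap γ) = Real.exp (-pairing f γ)) → P F)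
    (F : C(testFamily d → unitInterval, ℝ)) : P F := by
  let M : Submonoid C(testFamily d → unitInterval, ℝ) :=
    { carrier := {F | ∃ f : E d → ℝ, IsTest f ∧ ∀ γ, F (laplaceMap γ) = Real.exp (-pairing f γ)}
      one_mem' := ⟨0, isTest_zero, fun γ => by simp [pairing_zero]⟩
      mul_mem' := by
        rintro F G ⟨f, hf, hF⟩ ⟨g, hg, hG⟩
        refine ⟨f + g, hf.add hg, fun γ => ?_⟩
        rw [ContinuousMap.mul_apply, hF, hG, pairing_add hf.compact hg.compact, neg_add,
          Real.exp_add] }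
  let A : Subalgebra ℝ C(testFamily d → unitInterval, ℝ) :=
    Algebra.adjoin ℝ (M : Set C(testFamily d → unitInterval, ℝ))
  have hsep : A.SeparatesPoints := by
    intro x y hxy
    obtain ⟨f, hf⟩ := Function.ne_iff.1 hxy
    let c : C(testFamily d → unitInterval, ℝ) :=
      ⟨fun y => y f, continuous_subtype_val.comp (continuous_apply f)⟩
    refine ⟨c, ⟨c, Algebra.subset_adjoin ⟨f.1, isTest_of_mem_testFamily f.2, fun γ => ?_⟩, rfl⟩, ?_⟩
    · exact coe_laplaceCoord (isTest_of_mem_testFamily f.2).nonneg γ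
    · exact fun h => hf (Subtype.ext h)
  have hA : ∀ F ∈ A, P F := by
    intro F hF
    have hF' : F ∈ Submodule.span ℝ (M : Set C(testFamily d → unitInterval, ℝ)) := by
      have h := Algebra.adjoin_eq_span ℝ (M : Set C(testFamily d → unitInterval, ℝ))
      rw [Submonoid.closure_eq M] at h
      rw [← h]
      exact hF
    have hM : ∀ F ∈ M, P F := fun F ⟨f, hf, hF⟩ => test f hf F hF
    exact Submodule.span_induction (p := fun F _ => P F) hM
      (by simpa using smul 0 1 (hM 1 M.one_mem)) (fun F G _ _ => add F G)
      (fun c F _ => smul c F) hF'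
  have hF : F ∈ A.topologicalClosure := by
    rw [ContinuousMap.subalgebra_topologicalClosure_eq_top_of_separatesPoints A hsep]
    trivial
  exact closure_minimal (fun F hF => hA F hF) closed hF

lemma integrable_comp_laplaceMap (μ : Measure (Configuration d)) [IsFiniteMeasure μ]
    (F : C(testFamily d → unitInterval, ℝ)) : Integrable (fun γ => F (laplaceMap γ)) μ :=
  Integrable.of_bound (F.continuous.comp continuous_laplaceMap).aestronglyMeasurable ‖F‖
    (ae_of_all _ fun _ => F.norm_coe_le_norm _)

lemma abs_integral_comp_laplaceMap_sub_le (μ : Measure (Configuration d)) [IsProbabilityMeasure μ]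
    (F G : C(testFamily d → unitInterval, ℝ)) :
    |∫ γ, F (laplaceMap γ) ∂μ - ∫ γ, G (laplaceMap γ) ∂μ| ≤ ‖F - G‖ := by
  rw [← integral_sub (integrable_comp_laplaceMap μ F) (integrable_comp_laplaceMap μ G)]
  have h := norm_integral_le_of_norm_le_const (μ := μ)
    (f := fun γ => F (laplaceMap γ) - G (laplaceMap γ)) (C := ‖F - G‖)
    (ae_of_all _ fun _ => (F - G).norm_coe_le_norm _)
  simpa using h

/-- Convergence of Laplace functionals implies weak convergence. -/
theorem tendsto_of_tendsto_laplace {ι : Type*} {l : Filter ι} [l.IsCountablyGenerated]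
    {μs : ι → ProbabilityMeasure (Configuration d)} {μ : ProbabilityMeasure (Configuration d)}
    (h : ∀ f : E d → ℝ, IsTest f → Tendsto (fun i => ∫ γ, Real.exp (-pairing f γ) ∂(μs i)) l
      (𝓝 (∫ γ, Real.exp (-pairing f γ) ∂μ))) : Tendsto μs l (𝓝 μ) := by
  have hF : ∀ F : C(testFamily d → unitInterval, ℝ),
      Tendsto (fun i => ∫ γ, F (laplaceMap γ) ∂(μs i)) l (𝓝 (∫ γ, F (laplaceMap γ) ∂μ)) := by
    refine laplaceMap_induction ?_ ?_ ?_ ?_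
    · refine isClosed_of_closure_subset fun F hF => ?_
      refine Metric.tendsto_nhds.2 fun ε hε => ?_
      obtain ⟨G, hG, hFG⟩ := Metric.mem_closure_iff.1 hF (ε / 3) (by positivity)
      rw [dist_eq_norm] at hFG
      filter_upwards [Metric.tendsto_nhds.1 hG (ε / 3) (by positivity)] with i hi
      have h1 := abs_integral_comp_laplaceMap_sub_le (μs i : Measure (Configuration d)) F G
      have h2 := abs_integral_comp_laplaceMap_sub_le (μ : Measure (Configuration d)) F G
      rw [Real.dist_eq] at hi ⊢
      rw [abs_le] at h1 h2
      rw [abs_lt] at hi ⊢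
      constructor <;> linarith [h1.1, h1.2, h2.1, h2.2, hi.1, hi.2]
    · intro F G hF hG
      simp only [ContinuousMap.add_apply]
      have := hF.add hG
      simpa only [integral_add (integrable_comp_laplaceMap _ F) (integrable_comp_laplaceMap _ G)]
        using this
    · intro c F hF
      simp only [ContinuousMap.smul_apply, integral_smul]
      exact hF.const_smul c
    · intro f hf F hF
      simpa only [hF] using h f hf
  have hΦ : Measurable (laplaceMap (d := d)) := continuous_laplaceMap.measurable
  have hK : Tendsto (fun i => (μs i).map hΦ.aemeasurable) l (𝓝 (μ.map hΦ.aemeasurable)) := by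
    rw [ProbabilityMeasure.tendsto_iff_forall_integral_tendsto]
    intro F
    simp only [ProbabilityMeasure.toMeasure_map,
      integral_map hΦ.aemeasurable F.continuous.aestronglyMeasurable]
    exact hF F.toContinuousMap
  -- Weak convergence on the cube is carried back through open sets: each open set of configurations
  -- is the preimage of an open set of the cube.
  refine tendsto_of_forall_isOpen_le_liminf' fun G hG => ?_
  obtain ⟨U, hU, rfl⟩ := isInducing_laplaceMap.isOpen_iff.1 hG
  have := ProbabilityMeasure.le_liminf_measure_open_of_tendsto hK hU
  simpa only [ProbabilityMeasure.toMeasure_map, Measure.map_apply hΦ hU.measurableSet] using this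

/-- Probability measures with the same Laplace functional are equal. -/
theorem ext_of_laplace {μ ν : Measure (Configuration d)} [IsProbabilityMeasure μ]
    [IsProbabilityMeasure ν]
    (h : ∀ f : E d → ℝ, IsTest f →
      ∫ γ, Real.exp (-pairing f γ) ∂μ = ∫ γ, Real.exp (-pairing f γ) ∂ν) : μ = ν := by
  have hF : ∀ F : C(testFamily d → unitInterval, ℝ),
      ∫ γ, F (laplaceMap γ) ∂μ = ∫ γ, F (laplaceMap γ) ∂ν := by
    refine laplaceMap_induction ?_ ?_ ?_ ?_
    · refine isClosed_eq ?_ ?_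
      · refine (LipschitzWith.of_dist_le_mul (K := 1) fun F G => ?_).continuous
        simpa [dist_eq_norm] using abs_integral_comp_laplaceMap_sub_le μ F G
      · refine (LipschitzWith.of_dist_le_mul (K := 1) fun F G => ?_).continuous
        simpa [dist_eq_norm] using abs_integral_comp_laplaceMap_sub_le ν F G
    · intro F G hF hG
      simp only [ContinuousMap.add_apply]
      rw [integral_add (integrable_comp_laplaceMap _ F) (integrable_comp_laplaceMap _ G),
        integral_add (integrable_comp_laplaceMap _ F) (integrable_comp_laplaceMap _ G), hF, hG]
    · intro c F hF
      simp only [ContinuousMap.smul_apply, integral_smul, hF]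
    · intro f hf F hF
      simpa only [hF] using h f hf
  have hΦ : Measurable (laplaceMap (d := d)) := continuous_laplaceMap.measurable
  have hK : μ.map laplaceMap = ν.map laplaceMap := by
    have := Measure.isProbabilityMeasure_map (μ := μ) hΦ.aemeasurable
    have := Measure.isProbabilityMeasure_map (μ := ν) hΦ.aemeasurable
    refine ext_of_forall_integral_eq_of_IsFiniteMeasure fun F => ?_
    rw [integral_map hΦ.aemeasurable F.continuous.aestronglyMeasurable,
      integral_map hΦ.aemeasurable F.continuous.aestronglyMeasurable]
    exact hF F.toContinuousMap
  ext s hs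
  rw [measurableSpace_configuration_eq] at hs
  obtain ⟨t, ht, rfl⟩ := hs
  rw [← Measure.map_apply hΦ ht, ← Measure.map_apply hΦ ht, hK]

/-- A family of probability measures depends measurably on a parameter if its Laplace functional
does. -/
theorem measurable_of_measurable_laplace {α : Type*} [MeasurableSpace α]
    {κ : α → Measure (Configuration d)} (hκ : ∀ x, IsProbabilityMeasure (κ x))
    (h : ∀ f : E d → ℝ, IsTest f → Measurable fun x => ∫ γ, Real.exp (-pairing f γ) ∂(κ x)) :
    Measurable κ := by
  have hF : ∀ F : C(testFamily d → unitInterval, ℝ),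
      Measurable fun x => ∫ γ, F (laplaceMap γ) ∂(κ x) := by
    refine laplaceMap_induction ?_ ?_ ?_ ?_
    · refine isClosed_of_closure_subset fun F hF => ?_
      obtain ⟨G, hG, hGF⟩ := mem_closure_iff_seq_limit.1 hF
      refine measurable_of_tendsto_metrizable hG (tendsto_pi_nhds.2 fun x => ?_)
      refine tendsto_iff_dist_tendsto_zero.2 ?_
      refine squeeze_zero (fun _ => dist_nonneg)
        (fun n => abs_integral_comp_laplaceMap_sub_le (κ x) (G n) F) ?_
      simpa only [dist_eq_norm] using tendsto_iff_dist_tendsto_zero.1 hGF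
    · intro F G hF hG
      simp only [ContinuousMap.add_apply]
      simp only [integral_add (integrable_comp_laplaceMap _ F) (integrable_comp_laplaceMap _ G)]
      exact hF.add hG
    · intro c F hF
      simp only [ContinuousMap.smul_apply, integral_smul]
      exact hF.const_smul c
    · intro f hf F hF
      simpa only [hF] using h f hf
  have hΦ : Measurable (laplaceMap (d := d)) := continuous_laplaceMap.measurable
  -- Preimages of closed sets of the cube form a generating π-system, and the indicator of a closed
  -- set is a limit of continuous functions, to which `hF` applies.
  refine Measurable.measure_of_isPiSystem_of_isProbabilityMeasure
    (S := {s | ∃ t : Set (testFamily d → unitInterval), IsClosed t ∧ laplaceMap ⁻¹' t = s}) ?_ ?_ ?_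
  · rw [measurableSpace_configuration_eq, BorelSpace.measurable_eq (α := testFamily d → unitInterval),
      borel_eq_generateFrom_isClosed, MeasurableSpace.comap_generateFrom]
    rfl
  · exact isPiSystem_isClosed.comap _
  · rintro _ ⟨t, ht, rfl⟩
    have hlim : ∀ x, Tendsto (fun n => ∫⁻ γ, (ht.apprSeq n (laplaceMap γ) : ℝ≥0∞) ∂(κ x)) atTop
        (𝓝 (κ x (laplaceMap ⁻¹' t))) := by
      intro x
      have := Measure.isProbabilityMeasure_map (μ := κ x) hΦ.aemeasurable
      have h1 := HasOuterApproxClosed.tendsto_lintegral_apprSeq ht ((κ x).map laplaceMap)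
      rw [Measure.map_apply hΦ ht.measurableSet] at h1
      refine h1.congr fun n => ?_
      rw [lintegral_map (by fun_prop) hΦ]
    refine measurable_of_tendsto_metrizable (fun n => ?_) (tendsto_pi_nhds.2 hlim)
    let F : C(testFamily d → unitInterval, ℝ) := ⟨fun y => ht.apprSeq n y, by fun_prop⟩
    have h2 : (fun x => ∫⁻ γ, (ht.apprSeq n (laplaceMap γ) : ℝ≥0∞) ∂(κ x)) =
        fun x => ENNReal.ofReal (∫ γ, F (laplaceMap γ) ∂(κ x)) := by
      funext x
      rw [ofReal_integral_eq_lintegral_ofReal (integrable_comp_laplaceMap _ F)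
        (ae_of_all _ fun γ => NNReal.coe_nonneg _)]
      simp [F]
    rw [h2]
    exact (hF F).ennreal_ofReal

/-- A random configuration is measurable up to null sets if its pairings with test functions
are. -/
theorem aemeasurable_of_pairing {Ω : Type*} [MeasurableSpace Ω] {μ : Measure Ω}
    {X : Ω → Configuration d}
    (h : ∀ f : E d → ℝ, IsTest f → AEMeasurable (fun w => pairing f (X w)) μ) :
    AEMeasurable X μ := by
  have h1 : AEMeasurable (fun w => laplaceMap (X w)) μ := by
    refine aemeasurable_pi_iff.2 fun f => ?_
    have h2 := h f.1 (isTest_of_mem_testFamily f.2)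
    exact (aemeasurable_const.min h2.neg.exp).subtype_mk
  let N := toMeasurable μ {w | laplaceMap (X w) ≠ h1.mk _ w}
  have hN : μ N = 0 := by
    rw [measure_toMeasurable]
    exact h1.ae_eq_mk
  have hNm : MeasurableSet N := measurableSet_toMeasurable _ _
  classical
  let γ₀ : Configuration d := ⟨∅, fun _ _ => by simp⟩
  -- It is `X` itself that is changed on a null set, since the measurable version of `laplaceMap (X
  -- w)` need not take its values in the image of `laplaceMap`.
  refine ⟨fun w => if w ∈ N then γ₀ else X w, ?_, ?_⟩
  · rw [measurableSpace_configuration_eq, measurable_comap_iff]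
    have h3 : laplaceMap ∘ (fun w => if w ∈ N then γ₀ else X w) =
        fun w => if w ∈ N then laplaceMap γ₀ else h1.mk _ w := by
      funext w
      by_cases hw : w ∈ N
      · simp [hw]
      · have : laplaceMap (X w) = h1.mk _ w := by
          by_contra hne
          exact hw (subset_toMeasurable _ _ hne)
        simp [hw, this]
    rw [h3]
    exact Measurable.ite hNm measurable_const h1.measurable_mk
  · filter_upwards [measure_eq_zero_iff_ae_notMem.1 hN] with w hw
    simp [hw]

/-! ### Infinite products of probability measures -/

lemma lintegral_infinitePi_prod {ι : Type*} {Ω : ι → Type*} [∀ i, MeasurableSpace (Ω i)]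
    (μ : ∀ i, Measure (Ω i)) [∀ i, IsProbabilityMeasure (μ i)] (s : Finset ι)
    {F : ∀ i, Ω i → ℝ≥0∞} (hF : ∀ i, Measurable (F i)) :
    ∫⁻ w, ∏ i ∈ s, F i (w i) ∂Measure.infinitePi μ = ∏ i ∈ s, ∫⁻ x, F i x ∂μ i := by
  refine (lintegral_prod_eq_prod_lintegral_of_indepFun s (fun i (w : ∀ i, Ω i) => F i (w i))
    (iIndepFun_infinitePi hF) fun i => (hF i).comp (measurable_pi_apply i)).trans ?_
  refine Finset.prod_congr rfl fun i _ => ?_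
  rw [← lintegral_map (hF i) (measurable_pi_apply i), Measure.infinitePi_map_eval]

/-- Independent random variables almost surely differ if one of them has no atom except possibly
at a point that is not an atom of the other one. -/
lemma ae_infinitePi_ne {ι : Type*} {Ω : ι → Type*} [∀ i, MeasurableSpace (Ω i)]
    (μ : ∀ i, Measure (Ω i)) [∀ i, IsProbabilityMeasure (μ i)] {i j : ι} (hij : i ≠ j)
    {F : Ω i → E d} {G : Ω j → E d} (hF : Measurable F) (hG : Measurable G) (y : E d)
    (h₁ : μ i (F ⁻¹' {y}) = 0) (h₂ : ∀ x ≠ y, μ j (G ⁻¹' {x}) = 0) :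
    ∀ᵐ w ∂Measure.infinitePi μ, F (w i) ≠ G (w j) := by
  have hS : MeasurableSet {p : Ω i × Ω j | F p.1 = G p.2} :=
    measurableSet_eq_fun (hF.comp measurable_fst) (hG.comp measurable_snd)
  have h : ((μ i).prod (μ j)) {p : Ω i × Ω j | F p.1 = G p.2} = 0 := by
    rw [Measure.prod_apply hS, lintegral_eq_zero_iff (measurable_measure_prodMk_left hS)]
    have h₁' : ∀ᵐ a ∂μ i, F a ≠ y := measure_eq_zero_iff_ae_notMem.1 h₁
    filter_upwards [h₁'] with a ha
    refine Eq.trans ?_ (h₂ (F a) ha)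
    congr 1
    ext b
    simp [eq_comm]
  rw [← Measure.infinitePi_map_eval_prod hij, Measure.map_apply (by fun_prop) hS] at h
  exact measure_eq_zero_iff_ae_notMem.1 h

/-! ### The function `u ↦ e^{-u}` on `[0, ∞]` -/

/-- The function `u ↦ e^{-u}` on `[0, ∞]`. -/
noncomputable def expNeg (u : ℝ≥0∞) : ℝ≥0∞ := EReal.exp (-(u : EReal))

lemma continuous_expNeg : Continuous expNeg :=
  ENNReal.continuous_exp.comp (continuous_neg.comp continuous_coe_ennreal_ereal)

lemma expNeg_top : expNeg ⊤ = 0 := by simp [expNeg]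

lemma expNeg_zero : expNeg 0 = 1 := by simp [expNeg]

lemma expNeg_ofReal {r : ℝ} (hr : 0 ≤ r) :
    expNeg (ENNReal.ofReal r) = ENNReal.ofReal (Real.exp (-r)) := by
  rw [expNeg, EReal.coe_ennreal_ofReal, max_eq_left hr, ← EReal.coe_neg, EReal.exp_coe]

lemma expNeg_le_one (u : ℝ≥0∞) : expNeg u ≤ 1 := by
  rw [expNeg, EReal.exp_le_one_iff, EReal.neg_le, neg_zero]
  exact EReal.coe_ennreal_nonneg u

lemma expNeg_add (u v : ℝ≥0∞) : expNeg (u + v) = expNeg u * expNeg v := by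
  rw [expNeg, EReal.coe_ennreal_add, EReal.neg_add (by simp) (by simp), sub_eq_add_neg,
    EReal.exp_add, expNeg, expNeg]

lemma expNeg_sum {ι : Type*} (s : Finset ι) (u : ι → ℝ≥0∞) :
    expNeg (∑ i ∈ s, u i) = ∏ i ∈ s, expNeg (u i) := by
  classical
  induction s using Finset.induction_on with
  | empty => simp [expNeg_zero]
  | insert i s hi ih => rw [Finset.sum_insert hi, Finset.prod_insert hi, expNeg_add, ih]

/-- The Laplace transform of a countable sum of independent nonnegative random variables. -/
lemma lintegral_infinitePi_expNeg_tsum {ι : Type*} [Countable ι] {Ω : ι → Type*}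
    [∀ i, MeasurableSpace (Ω i)] (μ : ∀ i, Measure (Ω i)) [∀ i, IsProbabilityMeasure (μ i)]
    {h : ∀ i, Ω i → ℝ≥0∞} (hm : ∀ i, Measurable (h i)) {u : ι → ℝ≥0∞}
    (hu : ∀ i, ∫⁻ x, expNeg (h i x) ∂μ i = expNeg (u i)) :
    ∫⁻ w, expNeg (∑' i, h i (w i)) ∂Measure.infinitePi μ = expNeg (∑' i, u i) := by
  have h1 : Tendsto (fun s : Finset ι => ∫⁻ w, expNeg (∑ i ∈ s, h i (w i)) ∂Measure.infinitePi μ)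
      atTop (𝓝 (∫⁻ w, expNeg (∑' i, h i (w i)) ∂Measure.infinitePi μ)) := by
    refine tendsto_lintegral_filter_of_dominated_convergence (fun _ => 1)
      (Eventually.of_forall fun s => continuous_expNeg.measurable.comp
        (Finset.measurable_sum _ fun i _ => (hm i).comp (measurable_pi_apply i)))
      (Eventually.of_forall fun s => ae_of_all _ fun w => expNeg_le_one _) (by simp)
      (ae_of_all _ fun w => ?_)
    exact (continuous_expNeg.tendsto _).comp ENNReal.summable.hasSum
  have h2 : Tendsto (fun s : Finset ι => expNeg (∑ i ∈ s, u i)) atTop (𝓝 (expNeg (∑' i, u i))) :=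
    (continuous_expNeg.tendsto _).comp ENNReal.summable.hasSum
  refine tendsto_nhds_unique h1 (h2.congr fun s => ?_)
  simp only [expNeg_sum]
  rw [lintegral_infinitePi_prod μ s (F := fun i x => expNeg (h i x))
    fun i => continuous_expNeg.measurable.comp (hm i)]
  exact Finset.prod_congr rfl fun i _ => (hu i).symm

/-! ### Extended pairings -/

/-- The pairing `⟨v, γ⟩ ∈ [0, ∞]` of a configuration with a nonnegative function. -/
noncomputable def epairing (v : E d → ℝ) (γ : Configuration d) : ℝ≥0∞ :=
  ∑' x : γ.carrier, ENNReal.ofReal (v x)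

lemma ofReal_pairing {f : E d → ℝ} (hc : HasCompactSupport f) (h0 : ∀ x, 0 ≤ f x)
    (γ : Configuration d) : ENNReal.ofReal (pairing f γ) = epairing f γ :=
  ENNReal.ofReal_tsum_of_nonneg (fun x => h0 x) (summable_carrier hc γ)

/-- Continuous cutoff functions, equal to one on the ball of radius `n`. -/
noncomputable def tent (d n : ℕ) (x : E d) : ℝ := max 0 (min 1 (n + 1 - ‖x‖))

lemma continuous_tent (n : ℕ) : Continuous (tent d n) := by
  unfold tent
  fun_prop

lemma tent_nonneg (n : ℕ) (x : E d) : 0 ≤ tent d n x := le_max_left _ _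

lemma tent_le_one (n : ℕ) (x : E d) : tent d n x ≤ 1 := max_le zero_le_one (min_le_left _ _)

lemma tent_eq_one {n : ℕ} {x : E d} (hx : ‖x‖ ≤ n) : tent d n x = 1 := by
  rw [tent, min_eq_left (by linarith), max_eq_right zero_le_one]

lemma hasCompactSupport_tent (n : ℕ) : HasCompactSupport (tent d n) := by
  refine HasCompactSupport.intro (isCompact_closedBall (0 : E d) (n + 1)) fun x hx => ?_
  have hx' : (n + 1 : ℝ) < ‖x‖ := by simpa using hx
  exact max_eq_left ((min_le_right _ _).trans (by linarith))

lemma monotone_tent (x : E d) : Monotone fun n : ℕ => tent d n x := by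
  intro m n hmn
  have : (m : ℝ) ≤ n := Nat.cast_le.2 hmn
  exact max_le_max le_rfl (min_le_min le_rfl (by linarith))

lemma eventually_tent_eq_one (x : E d) : ∀ᶠ n : ℕ in atTop, tent d n x = 1 := by
  obtain ⟨N, hN⟩ := exists_nat_ge ‖x‖
  filter_upwards [eventually_ge_atTop N] with n hn
  exact tent_eq_one (hN.trans (Nat.cast_le.2 hn))

lemma countable_carrier (γ : Configuration d) : γ.carrier.Countable := by
  have h : γ.carrier = ⋃ n : ℕ, γ.carrier ∩ Metric.closedBall 0 n := by
    rw [← Set.inter_iUnion, Metric.iUnion_closedBall_nat, Set.inter_univ]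
  rw [h]
  exact Set.countable_iUnion fun n => (γ.locallyFinite _ (isCompact_closedBall _ _)).countable

/-- Monotone convergence for the counting measure on the points of `γ`. -/
lemma tendsto_epairing_mul_tent {v : E d → ℝ} (h0 : ∀ x, 0 ≤ v x) (γ : Configuration d) :
    Tendsto (fun n : ℕ => epairing (fun x => v x * tent d n x) γ) atTop (𝓝 (epairing v γ)) := by
  let : MeasurableSpace γ.carrier := ⊤
  unfold epairing
  simp only [← lintegral_count]
  refine lintegral_tendsto_of_tendsto_of_monotone (fun n => measurable_from_top.aemeasurable)
    (ae_of_all _ fun x m n hmn => ENNReal.ofReal_le_ofReal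
      (mul_le_mul_of_nonneg_left (monotone_tent _ hmn) (h0 _))) (ae_of_all _ fun x => ?_)
  refine tendsto_const_nhds.congr' ?_
  filter_upwards [eventually_tent_eq_one (x : E d)] with n hn
  rw [hn, mul_one]

lemma measurable_epairing {v : E d → ℝ} (hv : Continuous v) (h0 : ∀ x, 0 ≤ v x) :
    Measurable (epairing v) := by
  refine measurable_of_tendsto_metrizable (fun n => ?_)
    (tendsto_pi_nhds.2 fun γ => tendsto_epairing_mul_tent h0 γ)
  have hc : HasCompactSupport fun x => v x * tent d n x := (hasCompactSupport_tent n).mul_left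
  have h := (continuous_pairing (hv.mul (continuous_tent n)) hc).measurable.ennreal_ofReal
  refine (congrArg Measurable (funext fun γ => ?_)).mp h
  exact ofReal_pairing hc (fun x => mul_nonneg (h0 x) (tent_nonneg n x)) γ

/-! ### Configurations given by a family of points -/

/-- Finiteness in balls of integer radius gives local finiteness, which excludes the default value
of `Configuration.ofSet`. -/
lemma carrier_ofSet_image {ι : Type*} {p : ι → E d} {s : Set ι}
    (h : ∀ n : ℕ, {i ∈ s | ‖p i‖ ≤ n}.Finite) : (Configuration.ofSet (p '' s)).carrier = p '' s := by
  have h' : ∀ K : Set (E d), IsCompact K → ((p '' s) ∩ K).Finite := by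
    intro K hK
    obtain ⟨R, hR⟩ := hK.isBounded.exists_norm_le
    obtain ⟨n, hn⟩ := exists_nat_ge R
    refine ((h n).image p).subset ?_
    rintro _ ⟨⟨i, hi, rfl⟩, hiK⟩
    exact ⟨i, ⟨hi, (hR _ hiK).trans hn⟩, rfl⟩
  rw [Configuration.ofSet, dif_pos h']

lemma pairing_ofSet_image {ι : Type*} {p : ι → E d} {s : Set ι} (hp : Set.InjOn p s)
    (h : ∀ n : ℕ, {i ∈ s | ‖p i‖ ≤ n}.Finite) (φ : E d → ℝ) :
    pairing φ (Configuration.ofSet (p '' s)) = ∑' i : s, φ (p i) := by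
  unfold pairing
  rw [carrier_ofSet_image h]
  exact tsum_image φ hp

/-! ### Construction of Poisson measures -/

/-- The shells `{n ≤ |x| < n + 1}` partition the space. -/
def shell (d n : ℕ) : Set (E d) := {x | (n : ℝ) ≤ ‖x‖ ∧ ‖x‖ < n + 1}

lemma measurableSet_shell (n : ℕ) : MeasurableSet (shell d n) :=
  (measurableSet_le measurable_const measurable_norm).inter
    (measurableSet_lt measurable_norm measurable_const)

lemma mem_shell_iff {n : ℕ} {x : E d} : x ∈ shell d n ↔ ⌊‖x‖⌋₊ = n :=
  (Nat.floor_eq_iff (norm_nonneg x)).symm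

lemma volume_shell_lt_top (n : ℕ) : volume (shell d n) < ⊤ :=
  (measure_mono fun x hx => by simpa using hx.2.le).trans_lt
    (measure_closedBall_lt_top (x := (0 : E d)) (r := n + 1))

lemma volume_shell_pos (hd : 0 < d) (n : ℕ) : 0 < volume (shell d n) := by
  have : Nonempty (Fin d) := ⟨⟨0, hd⟩⟩
  have hU : IsOpen {x : E d | (n : ℝ) < ‖x‖ ∧ ‖x‖ < n + 1} :=
    (isOpen_lt continuous_const continuous_norm).inter (isOpen_lt continuous_norm continuous_const)
  obtain ⟨x, hx⟩ := exists_norm_eq (E d) (show (0 : ℝ) ≤ n + 1 / 2 by positivity)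
  refine (hU.measure_pos volume ⟨x, ?_, ?_⟩).trans_le
    (measure_mono fun y hy => ⟨hy.1.le, hy.2⟩)
  · rw [hx]; linarith
  · rw [hx]; linarith

/-- A finite measure on a shell without atoms is a multiple of a probability measure on this shell
without atoms. -/
lemma exists_cellLaw (hd : 0 < d) (n : ℕ) (m : Measure (E d)) [IsFiniteMeasure m]
    (hm : m ≪ volume) (hs : m (shell d n)ᶜ = 0) :
    ∃ ρ : Measure (E d), IsProbabilityMeasure ρ ∧ ρ (shell d n)ᶜ = 0 ∧ (∀ x, ρ {x} = 0) ∧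
      m = m Set.univ • ρ := by
  have : Nonempty (Fin d) := ⟨⟨0, hd⟩⟩
  by_cases h0 : m Set.univ = 0
  -- For mass zero any atomless law on the shell will do; the uniform one is taken.
  · have hpos := (volume_shell_pos hd n).ne'
    have hfin := (volume_shell_lt_top (d := d) n).ne
    refine ⟨(volume (shell d n))⁻¹ • volume.restrict (shell d n), ⟨?_⟩, ?_, fun x => ?_, ?_⟩
    · simp [ENNReal.inv_mul_cancel hpos hfin]
    · simp [Measure.restrict_apply (measurableSet_shell n).compl]
    · simp
    · rw [h0, zero_smul]
      exact Measure.measure_univ_eq_zero.1 h0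
  · refine ⟨(m Set.univ)⁻¹ • m, ⟨?_⟩, ?_, fun x => ?_, ?_⟩
    · simp [ENNReal.inv_mul_cancel h0 (measure_ne_top m _)]
    · simp [hs]
    · simp [hm (measure_singleton x)]
    · rw [smul_smul, ENNReal.mul_inv_cancel h0 (measure_ne_top m _), one_smul]

/-- The randomness of one cell: the number of points and an infinite sequence of points. -/
noncomputable def cellMeasure (r : ℝ≥0) (ρ : Measure (E d)) [IsProbabilityMeasure ρ] :
    Measure (ℕ × (ℕ → E d)) :=
  (ProbabilityTheory.poissonMeasure r).prod (Measure.infinitePi fun _ => ρ)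

instance (r : ℝ≥0) (ρ : Measure (E d)) [IsProbabilityMeasure ρ] :
    IsProbabilityMeasure (cellMeasure r ρ) := by
  unfold cellMeasure
  infer_instance

lemma lintegral_poissonMeasure_pow (r : ℝ≥0) {c : ℝ} (hc : 0 ≤ c) :
    ∫⁻ n, ENNReal.ofReal c ^ n ∂ProbabilityTheory.poissonMeasure r =
      ENNReal.ofReal (Real.exp (r * c - r)) := by
  have h : HasSum (fun n : ℕ => Real.exp (-r) * r ^ n / n.factorial * c ^ n)
      (Real.exp (r * c - r)) := by
    convert! (NormedSpace.expSeries_div_hasSum_exp (r * c : ℝ)).mul_left (Real.exp (-r)) using 1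
    · funext n
      rw [mul_pow]
      ring
    · rw [← Real.exp_eq_exp_ℝ, ← Real.exp_add]
      ring_nf
  rw [ProbabilityTheory.poissonMeasure, lintegral_sum_measure, ← h.tsum_eq,
    ENNReal.ofReal_tsum_of_nonneg (fun n => by positivity) h.summable]
  refine tsum_congr fun n => ?_
  rw [lintegral_smul_measure, lintegral_dirac, smul_eq_mul, ← ENNReal.ofReal_pow hc,
    ← ENNReal.ofReal_mul (by positivity)]

/-- Given that there are `n` points, the product has expectation `(∫ φ dρ)^n`; the generating
function of the Poisson law then gives the sum over `n`. -/
lemma lintegral_cellMeasure_prod (r : ℝ≥0) (ρ : Measure (E d)) [IsProbabilityMeasure ρ]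
    {φ : E d → ℝ} (hφ : Measurable φ) (hφ0 : ∀ x, 0 ≤ φ x) (hi : Integrable φ ρ) :
    ∫⁻ p, ∏ i ∈ Finset.range p.1, ENNReal.ofReal (φ (p.2 i)) ∂cellMeasure r ρ =
      ENNReal.ofReal (Real.exp (r * ∫ x, φ x ∂ρ - r)) := by
  rw [cellMeasure, lintegral_prod _ (by
    refine Measurable.aemeasurable (measurable_from_prod_countable_right fun n => ?_)
    dsimp only
    fun_prop)]
  have h : ∀ n : ℕ, ∫⁻ w : ℕ → E d, ∏ i ∈ Finset.range n, ENNReal.ofReal (φ (w i))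
      ∂Measure.infinitePi (fun _ => ρ) = ENNReal.ofReal (∫ x, φ x ∂ρ) ^ n := by
    intro n
    rw [lintegral_infinitePi_prod (fun _ => ρ) (Finset.range n)
      (F := fun _ x => ENNReal.ofReal (φ x)) fun _ => hφ.ennreal_ofReal, Finset.prod_const,
      Finset.card_range, ofReal_integral_eq_lintegral_ofReal hi (ae_of_all _ hφ0)]
  simp only [h]
  exact lintegral_poissonMeasure_pow r (integral_nonneg hφ0)

/-- The points that are present in a realization of all the cells. -/
def cellIndices (w : ℕ → ℕ × (ℕ → E d)) : Set (ℕ × ℕ) := {p | p.2 < (w p.1).1}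

/-- The points of a realization of all the cells. -/
def cellPoint (w : ℕ → ℕ × (ℕ → E d)) (p : ℕ × ℕ) : E d := (w p.1).2 p.2

/-- A point of the cell `j` has norm at least `j`, so only the cells `0, …, n` matter, and each has
finitely many points. -/
lemma finite_cellIndices {w : ℕ → ℕ × (ℕ → E d)} (hw : ∀ p, cellPoint w p ∈ shell d p.1) (n : ℕ) :
    {p ∈ cellIndices w | ‖cellPoint w p‖ ≤ n}.Finite := by
  refine ((Finset.range (n + 1)).sigma fun j => Finset.range (w j).1).finite_toSet.image
    (fun q => (q.1, q.2)) |>.subset ?_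
  rintro ⟨j, i⟩ ⟨h1, h2⟩
  have h3 := (hw (j, i)).1
  have h4 : j ≤ n := by exact_mod_cast h3.trans h2
  have h5 : i < (w j).1 := h1
  exact ⟨⟨j, i⟩, by simpa [Nat.lt_succ_iff, h4] using h5, rfl⟩

lemma tsum_cellIndices {w : ℕ → ℕ × (ℕ → E d)} (hw : ∀ p, cellPoint w p ∈ shell d p.1)
    {φ : E d → ℝ} {J : ℕ} (hφ : ∀ x, φ x ≠ 0 → ‖x‖ < J) :
    ∑' p : cellIndices w, φ (cellPoint w p) =
      ∑ j ∈ Finset.range J, ∑ i ∈ Finset.range (w j).1, φ ((w j).2 i) := by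
  rw [tsum_subtype (cellIndices w) fun p => φ (cellPoint w p), Finset.sum_sigma',
    tsum_eq_sum (s := ((Finset.range J).sigma fun j => Finset.range (w j).1).map
      (Equiv.sigmaEquivProd ℕ ℕ).toEmbedding), Finset.sum_map]
  · refine Finset.sum_congr rfl fun q hq => ?_
    have h : (Equiv.sigmaEquivProd ℕ ℕ) q ∈ cellIndices w :=
      Finset.mem_range.1 (Finset.mem_sigma.1 hq).2
    rw [Equiv.coe_toEmbedding, Set.indicator_of_mem h]
    rfl
  · rintro ⟨j, i⟩ hp
    refine Set.indicator_apply_eq_zero.2 fun hji => ?_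
    by_contra h
    have h3 := (hw (j, i)).1.trans_lt (hφ _ h)
    have h4 : j < J := by exact_mod_cast h3
    exact hp (Finset.mem_map.2 ⟨⟨j, i⟩, Finset.mem_sigma.2 ⟨Finset.mem_range.2 h4,
      Finset.mem_range.2 hji⟩, rfl⟩)

/-- Existence of Poisson measures; the Laplace functional is given for all continuous functions
with compact support. -/
theorem exists_poisson (hd : 0 < d) {z : E d → ℝ} (hz : Measurable z) (hz0 : ∀ x, 0 ≤ z x)
    {M : ℝ} (hM : ∀ x, z x ≤ M) :
    ∃ π : Measure (Configuration d), IsProbabilityMeasure π ∧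
      ∀ φ : E d → ℝ, Continuous φ → HasCompactSupport φ →
        ∫ γ, Real.exp (pairing φ γ) ∂π = Real.exp (∫ x, (Real.exp (φ x) - 1) * z x) := by
  let ζ : Measure (E d) := volume.withDensity fun x => ENNReal.ofReal (z x)
  have hζ : ∀ s, volume s < ⊤ → ζ s < ⊤ := by
    intro s hs
    rw [withDensity_apply' _ s]
    calc ∫⁻ x in s, ENNReal.ofReal (z x) ≤ ∫⁻ _ in s, ENNReal.ofReal M :=
          lintegral_mono fun x => ENNReal.ofReal_le_ofReal (hM x)
      _ = ENNReal.ofReal M * volume s := by simp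
      _ < ⊤ := ENNReal.mul_lt_top ENNReal.ofReal_lt_top hs
  let m : ℕ → Measure (E d) := fun j => ζ.restrict (shell d j)
  have hmfin : ∀ j, IsFiniteMeasure (m j) := fun j => ⟨by
    rw [Measure.restrict_apply_univ]
    exact hζ _ (volume_shell_lt_top j)⟩
  choose ρ hρ hρs hρa hρm using fun j => exists_cellLaw hd j (m j)
    (Measure.absolutelyContinuous_of_le Measure.restrict_le_self |>.trans
      (withDensity_absolutelyContinuous _ _))
    (by rw [Measure.restrict_apply (measurableSet_shell j).compl]; simp)
  let r : ℕ → ℝ≥0 := fun j => (m j Set.univ).toNNReal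
  have hmr : ∀ j, m j = (r j : ℝ≥0∞) • ρ j := fun j => by
    rw [ENNReal.coe_toNNReal (measure_ne_top _ _)]
    exact hρm j
  let P : Measure (ℕ → ℕ × (ℕ → E d)) := Measure.infinitePi fun j => cellMeasure (r j) (ρ j)
  -- almost surely, all points lie in their cells and are distinct
  have hsnd : ∀ j, MeasurePreserving (fun w : ℕ → ℕ × (ℕ → E d) => (w j).2) P
      (Measure.infinitePi fun _ => ρ j) := fun j =>
    measurePreserving_snd.comp (measurePreserving_eval_infinitePi _ j)
  have hcell : ∀ᵐ w ∂P, ∀ p, cellPoint w p ∈ shell d p.1 := by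
    refine ae_all_iff.2 fun p => ?_
    have h : MeasurePreserving (fun w => cellPoint w p) P (ρ p.1) :=
      (measurePreserving_eval_infinitePi (fun _ => ρ p.1) p.2).comp (hsnd p.1)
    refine h.quasiMeasurePreserving.ae (p := fun x => x ∈ shell d p.1) ?_
    exact hρs p.1
  have hdist : ∀ᵐ w ∂P, ∀ (j i i' : ℕ), i ≠ i' → (w j).2 i ≠ (w j).2 i' := by
    refine ae_all_iff.2 fun j => ae_all_iff.2 fun i => ae_all_iff.2 fun i' => ?_
    by_cases hii : i = i'
    · simp [hii]
    have h := ae_infinitePi_ne (fun _ : ℕ => ρ j) hii measurable_id measurable_id 0 (hρa j _)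
      fun x _ => hρa j x
    filter_upwards [(hsnd j).quasiMeasurePreserving.ae h] with w hw _
    exact hw
  let X : (ℕ → ℕ × (ℕ → E d)) → Configuration d :=
    fun w => Configuration.ofSet (cellPoint w '' cellIndices w)
  have hX : ∀ (φ : E d → ℝ) (J : ℕ), (∀ x, φ x ≠ 0 → ‖x‖ < J) → ∀ᵐ w ∂P, pairing φ (X w) =
      ∑ j ∈ Finset.range J, ∑ i ∈ Finset.range (w j).1, φ ((w j).2 i) := by
    intro φ J hφ
    filter_upwards [hcell, hdist] with w hw hw'
    rw [← tsum_cellIndices hw hφ]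
    refine pairing_ofSet_image (Function.Injective.injOn ?_) (finite_cellIndices hw) φ
    rintro ⟨j, i⟩ ⟨j', i'⟩ h
    -- Coinciding points have the same norm and so come from the same cell, within which all points
    -- are distinct.
    have h1 := mem_shell_iff.1 (hw (j, i))
    have h2 := mem_shell_iff.1 (hw (j', i'))
    rw [h, h2] at h1
    dsimp only at h1
    subst h1
    by_contra hne
    exact hw' j' i i' (fun hii => hne (by rw [hii])) h
  have hmeas : ∀ (φ : E d → ℝ), Measurable φ → ∀ j, Measurable fun w : ℕ → ℕ × (ℕ → E d) =>
      ∑ i ∈ Finset.range (w j).1, φ ((w j).2 i) := by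
    intro φ hφ j
    have h : Measurable fun p : ℕ × (ℕ → E d) => ∑ i ∈ Finset.range p.1, φ (p.2 i) := by
      refine measurable_from_prod_countable_right fun n => ?_
      dsimp only
      fun_prop
    exact h.comp (measurable_pi_apply j)
  have hXm : AEMeasurable X P := by
    refine aemeasurable_of_pairing fun f hf => ?_
    obtain ⟨J, hJ⟩ := exists_norm_lt_of_ne_zero hf.compact
    exact (Finset.measurable_sum _ fun j _ =>
      hmeas f hf.continuous.measurable j).aemeasurable.congr ((hX f J hJ).mono fun w hw => hw.symm)
  refine ⟨P.map X, Measure.isProbabilityMeasure_map hXm, fun φ hφ hc => ?_⟩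
  obtain ⟨J, hJ⟩ := exists_norm_lt_of_ne_zero hc
  have hexp : Measurable fun x => Real.exp (φ x) := hφ.measurable.exp
  obtain ⟨B, hB⟩ := hc.exists_bound_of_continuous hφ
  have hexpB : ∀ x, ‖Real.exp (φ x)‖ ≤ Real.exp B := fun x => by
    rw [Real.norm_of_nonneg (Real.exp_pos _).le]
    exact Real.exp_le_exp.2 ((le_abs_self _).trans (hB x))
  have hint : ∀ (μ : Measure (E d)) [IsFiniteMeasure μ], Integrable (fun x => Real.exp (φ x)) μ :=
    fun μ _ => Integrable.of_bound hexp.aestronglyMeasurable _ (ae_of_all _ hexpB)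
  -- The exponent `r_j (∫ e^φ dρ_j - 1)` of the cell `j` is the contribution of its shell to the
  -- exponent required of the Poisson measure.
  have hcellexp : ∀ j, (r j : ℝ) * ∫ x, Real.exp (φ x) ∂ρ j - r j =
      ∫ x in shell d j, (Real.exp (φ x) - 1) * z x := by
    intro j
    have h1 : (r j : ℝ) * ∫ x, Real.exp (φ x) ∂ρ j = ∫ x, Real.exp (φ x) ∂m j := by
      rw [hmr j, integral_smul_measure]
      simp
    have h2 : (r j : ℝ) = ∫ x, 1 ∂m j := by
      rw [integral_const, smul_eq_mul, mul_one]
      rfl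
    rw [h1]
    nth_rewrite 1 [h2]
    have h3 : m j = (volume.restrict (shell d j)).withDensity fun x => ENNReal.ofReal (z x) :=
      restrict_withDensity (measurableSet_shell j) _
    rw [← integral_sub (hint (m j)) (integrable_const _), h3,
      integral_withDensity_eq_integral_toReal_smul hz.ennreal_ofReal
        (ae_of_all _ fun _ => ENNReal.ofReal_lt_top)]
    refine integral_congr_ae (ae_of_all _ fun x => ?_)
    simp only [ENNReal.toReal_ofReal (hz0 x), smul_eq_mul]
    ring
  rw [integral_map hXm (by
    exact (continuous_pairing hφ hc).rexp.aestronglyMeasurable)]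
  rw [integral_eq_lintegral_of_nonneg_ae (ae_of_all _ fun w => (Real.exp_pos _).le)
    (((continuous_pairing hφ hc).rexp.measurable.comp_aemeasurable hXm).aestronglyMeasurable)]
  have h1 : ∫⁻ w, ENNReal.ofReal (Real.exp (pairing φ (X w))) ∂P =
      ∫⁻ w, ∏ j ∈ Finset.range J, ∏ i ∈ Finset.range (w j).1,
        ENNReal.ofReal (Real.exp (φ ((w j).2 i))) ∂P := by
    refine lintegral_congr_ae ?_
    filter_upwards [hX φ J hJ] with w hw
    rw [hw, Real.exp_sum, ENNReal.ofReal_prod_of_nonneg fun j _ => (Real.exp_pos _).le]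
    refine Finset.prod_congr rfl fun j _ => ?_
    rw [Real.exp_sum, ENNReal.ofReal_prod_of_nonneg fun j _ => (Real.exp_pos _).le]
  rw [h1, lintegral_infinitePi_prod (fun j => cellMeasure (r j) (ρ j)) (Finset.range J)
    (F := fun j p => ∏ i ∈ Finset.range p.1, ENNReal.ofReal (Real.exp (φ (p.2 i)))) fun j => by
      refine measurable_from_prod_countable_right fun n => ?_
      dsimp only
      fun_prop]
  have h2 : ∀ j, ∫⁻ p, ∏ i ∈ Finset.range p.1, ENNReal.ofReal (Real.exp (φ (p.2 i)))
      ∂cellMeasure (r j) (ρ j) =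
        ENNReal.ofReal (Real.exp (∫ x in shell d j, (Real.exp (φ x) - 1) * z x)) := fun j => by
    rw [lintegral_cellMeasure_prod (r j) (ρ j) hexp (fun x => (Real.exp_pos _).le) (hint _),
      hcellexp]
  simp only [h2]
  rw [← ENNReal.ofReal_prod_of_nonneg fun j _ => (Real.exp_pos _).le, ← Real.exp_sum,
    ENNReal.toReal_ofReal (Real.exp_pos _).le]
  congr 1
  have hfint : ∀ j ∈ Finset.range J,
      IntegrableOn (fun x => (Real.exp (φ x) - 1) * z x) (shell d j) := by
    intro j _
    have : IsFiniteMeasure (volume.restrict (shell d j)) :=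
      ⟨by simpa using volume_shell_lt_top j⟩
    refine Integrable.of_bound ((hexp.sub_const 1).mul hz).aestronglyMeasurable
      ((Real.exp B + 1) * M) (ae_of_all _ fun x => ?_)
    rw [norm_mul, Real.norm_of_nonneg (hz0 x)]
    refine mul_le_mul ((norm_sub_le _ _).trans ?_) (hM x) (hz0 x) (by positivity)
    simpa using hexpB x
  rw [← integral_biUnion_finset _ (fun j _ => measurableSet_shell j) ?_ hfint]
  · refine setIntegral_eq_integral_of_forall_compl_eq_zero fun x hx => ?_
    by_cases hφx : φ x = 0
    · simp [hφx]
    · refine absurd (Set.mem_iUnion₂.2 ⟨⌊‖x‖⌋₊, ?_, mem_shell_iff.2 rfl⟩) hx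
      exact Finset.mem_range.2 ((Nat.floor_lt (norm_nonneg x)).2 (hJ x hφx))
  · intro j _ j' _ hjj
    refine Set.disjoint_left.2 fun x hx hx' => hjj ?_
    rw [← mem_shell_iff.1 hx, mem_shell_iff.1 hx']

/-! ### The Laplace functional of Poisson measures -/

section Poisson

variable {z : E d → ℝ} {M : ℝ}

theorem isPoissonMeasure_poissonMeasure (hd : 0 < d) (hz : Measurable z) (hz0 : ∀ x, 0 ≤ z x)
    (hM : ∀ x, z x ≤ M) : IsPoissonMeasure z (poissonMeasure z) := by
  obtain ⟨π, hπ, h⟩ := exists_poisson hd hz hz0 hM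
  have hex : ∃ π : Measure (Configuration d), IsPoissonMeasure z π :=
    ⟨π, hπ, fun φ hφ hc => h φ hφ.continuous hc⟩
  rw [poissonMeasure, dif_pos hex]
  exact hex.choose_spec

/-- The definition gives the formula for smooth `φ` only. The measure constructed above satisfies it
for all continuous `φ`, and the two coincide because their Laplace functionals agree on test
functions. -/
theorem integral_exp_pairing_poissonMeasure (hd : 0 < d) (hz : Measurable z) (hz0 : ∀ x, 0 ≤ z x)
    (hM : ∀ x, z x ≤ M) {φ : E d → ℝ} (hφ : Continuous φ) (hc : HasCompactSupport φ) :
    ∫ γ, Real.exp (pairing φ γ) ∂poissonMeasure z =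
      Real.exp (∫ x, (Real.exp (φ x) - 1) * z x) := by
  obtain ⟨π, hπ, h⟩ := exists_poisson hd hz hz0 hM
  obtain ⟨hp, hp'⟩ := isPoissonMeasure_poissonMeasure hd hz hz0 hM
  have heq : poissonMeasure z = π := by
    refine ext_of_laplace fun f hf => ?_
    have hneg : ∀ γ, -pairing f γ = pairing (-f) γ := fun γ => tsum_neg.symm
    simp only [hneg]
    rw [hp' (-f) hf.smooth.neg hf.compact.neg, h (-f) hf.continuous.neg hf.compact.neg]
  rw [heq, h φ hφ hc]

lemma integrable_one_sub_exp_neg_mul (hz : Measurable z) (hz0 : ∀ x, 0 ≤ z x)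
    (hM : ∀ x, z x ≤ M) {v : E d → ℝ} (hv : Continuous v) (hc : HasCompactSupport v) :
    Integrable fun x => (1 - Real.exp (-v x)) * z x := by
  have h : Integrable fun x => 1 - Real.exp (-v x) :=
    (continuous_const.sub hv.neg.rexp).integrable_of_hasCompactSupport
      (hc.mono fun x hx h => hx (by simp [h]))
  refine h.mul_bdd (c := M) hz.aestronglyMeasurable (ae_of_all _ fun x => ?_)
  rw [Real.norm_of_nonneg (hz0 x)]
  exact hM x

lemma one_sub_exp_neg_nonneg {v : ℝ} (hv : 0 ≤ v) : 0 ≤ 1 - Real.exp (-v) :=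
  sub_nonneg.2 (Real.exp_le_one_iff.2 (neg_nonpos.2 hv))

/-- The Laplace functional of a Poisson measure at nonnegative continuous functions. -/
theorem lintegral_expNeg_epairing (hd : 0 < d) (hz : Measurable z) (hz0 : ∀ x, 0 ≤ z x)
    (hM : ∀ x, z x ≤ M) {v : E d → ℝ} (hv : Continuous v) (hv0 : ∀ x, 0 ≤ v x) :
    ∫⁻ γ, expNeg (epairing v γ) ∂poissonMeasure z =
      expNeg (∫⁻ x, ENNReal.ofReal ((1 - Real.exp (-v x)) * z x)) := by
  have := (isPoissonMeasure_poissonMeasure hd hz hz0 hM).1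
  let u : ℕ → E d → ℝ := fun n x => v x * tent d n x
  have hu : ∀ n, Continuous (u n) := fun n => hv.mul (continuous_tent n)
  have huc : ∀ n, HasCompactSupport (u n) := fun n => (hasCompactSupport_tent n).mul_left
  have hu0 : ∀ n x, 0 ≤ u n x := fun n x => mul_nonneg (hv0 x) (tent_nonneg n x)
  have h1 : Tendsto (fun n => ∫⁻ γ, expNeg (epairing (u n) γ) ∂poissonMeasure z) atTop
      (𝓝 (∫⁻ γ, expNeg (epairing v γ) ∂poissonMeasure z)) := by
    refine tendsto_lintegral_filter_of_dominated_convergence (fun _ => 1)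
      (Eventually.of_forall fun n => continuous_expNeg.measurable.comp
        (measurable_epairing (hu n) (hu0 n)))
      (Eventually.of_forall fun n => ae_of_all _ fun γ => expNeg_le_one _) (by simp)
      (ae_of_all _ fun γ => ?_)
    exact (continuous_expNeg.tendsto _).comp (tendsto_epairing_mul_tent hv0 γ)
  have h2 : Tendsto (fun n => expNeg (∫⁻ x, ENNReal.ofReal ((1 - Real.exp (-u n x)) * z x))) atTop
      (𝓝 (expNeg (∫⁻ x, ENNReal.ofReal ((1 - Real.exp (-v x)) * z x)))) := by
    refine (continuous_expNeg.tendsto _).comp ?_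
    refine lintegral_tendsto_of_tendsto_of_monotone
      (fun n => (((continuous_const.sub (hu n).neg.rexp).measurable.mul hz).ennreal_ofReal).aemeasurable)
      (ae_of_all _ fun x m n hmn => ?_) (ae_of_all _ fun x => ?_)
    · refine ENNReal.ofReal_le_ofReal (mul_le_mul_of_nonneg_right ?_ (hz0 x))
      refine sub_le_sub_left (Real.exp_le_exp.2 (neg_le_neg ?_)) _
      exact mul_le_mul_of_nonneg_left (monotone_tent x hmn) (hv0 x)
    · refine tendsto_const_nhds.congr' ?_
      filter_upwards [eventually_tent_eq_one x] with n hn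
      simp only [u, hn, mul_one]
  refine tendsto_nhds_unique h1 (h2.congr fun n => ?_)
  have h3 := integral_exp_pairing_poissonMeasure hd hz hz0 hM (hu n).neg (huc n).neg
  have h4 : ∀ γ, expNeg (epairing (u n) γ) = ENNReal.ofReal (Real.exp (pairing (-u n) γ)) := by
    intro γ
    rw [← ofReal_pairing (huc n) (hu0 n), expNeg_ofReal (pairing_nonneg (hu0 n) γ)]
    congr 2
    exact tsum_neg.symm
  have h5 : ∀ x, (Real.exp ((-u n) x) - 1) * z x = -((1 - Real.exp (-u n x)) * z x) := fun x => by
    simp only [Pi.neg_apply]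
    ring
  have h6 : ∀ x, 0 ≤ (1 - Real.exp (-u n x)) * z x := fun x =>
    mul_nonneg (one_sub_exp_neg_nonneg (hu0 n x)) (hz0 x)
  simp only [h4]
  rw [← ofReal_integral_eq_lintegral_ofReal
      (integrable_one_sub_exp_neg_mul hz hz0 hM (hu n) (huc n)) (ae_of_all _ h6),
    expNeg_ofReal (integral_nonneg h6), ← integral_neg, ← ofReal_integral_eq_lintegral_ofReal _
      (ae_of_all _ fun γ => (Real.exp_pos _).le), h3]
  · simp only [h5]
  · refine Integrable.of_bound (continuous_pairing (hu n).neg (huc n).neg).rexp.aestronglyMeasurable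
      1 (ae_of_all _ fun γ => ?_)
    rw [Real.norm_of_nonneg (Real.exp_pos _).le, Real.exp_le_one_iff]
    exact tsum_nonpos fun x => neg_nonpos.2 (hu0 n x)

lemma epairing_const_mul {s : ℝ} (hs : 0 ≤ s) (v : E d → ℝ) (γ : Configuration d) :
    epairing (fun x => s * v x) γ = ENNReal.ofReal s * epairing v γ := by
  simp only [epairing, ENNReal.ofReal_mul hs, ENNReal.tsum_mul_left]

/-- A Poisson configuration almost surely has a finite pairing with a function that is integrable
with respect to the intensity. -/
theorem ae_epairing_ne_top (hd : 0 < d) (hz : Measurable z) (hz0 : ∀ x, 0 ≤ z x)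
    (hM : ∀ x, z x ≤ M) {v : E d → ℝ} (hv : Continuous v) (hv0 : ∀ x, 0 ≤ v x)
    (hvz : ∫⁻ x, ENNReal.ofReal (v x * z x) ≠ ⊤) :
    ∀ᵐ γ ∂poissonMeasure z, epairing v γ ≠ ⊤ := by
  have := (isPoissonMeasure_poissonMeasure hd hz hz0 hM).1
  have hm : MeasurableSet {γ : Configuration d | epairing v γ ≠ ⊤} :=
    (measurable_epairing hv hv0 (measurableSet_singleton ⊤)).compl
  let I := ∫⁻ x, ENNReal.ofReal (v x * z x)
  -- With `s = 1 / (n + 1)`, the inequality `1 - e^{-u} ≤ u` gives `e^{-sI} ≤ ∫ e^{-s⟨v, γ⟩}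
  -- π_z(dγ)`, and the integrand vanishes where the pairing is infinite. As `s → 0`, the left side
  -- tends to one.
  have hle : ∀ n : ℕ, expNeg (ENNReal.ofReal (1 / ((n : ℝ) + 1)) * I) ≤
      poissonMeasure z {γ | epairing v γ ≠ ⊤} := by
    intro n
    have hs : 0 < 1 / ((n : ℝ) + 1) := by positivity
    set s := 1 / ((n : ℝ) + 1)
    calc expNeg (ENNReal.ofReal s * I)
        ≤ expNeg (∫⁻ x, ENNReal.ofReal ((1 - Real.exp (-(s * v x))) * z x)) := by
          refine EReal.exp_monotone (EReal.neg_le_neg_iff.2 (EReal.coe_ennreal_le_coe_ennreal_iff.2 ?_))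
          have hvzm : Measurable fun x => ENNReal.ofReal (v x * z x) :=
            (hv.measurable.mul hz).ennreal_ofReal
          change _ ≤ ENNReal.ofReal s * ∫⁻ x, ENNReal.ofReal (v x * z x)
          rw [← lintegral_const_mul _ hvzm]
          refine lintegral_mono fun x => ?_
          rw [← ENNReal.ofReal_mul hs.le, ← mul_assoc]
          refine ENNReal.ofReal_le_ofReal (mul_le_mul_of_nonneg_right ?_ (hz0 x))
          linarith [Real.add_one_le_exp (-(s * v x))]
      _ = ∫⁻ γ, expNeg (ENNReal.ofReal s * epairing v γ) ∂poissonMeasure z := by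
          rw [← lintegral_expNeg_epairing hd hz hz0 hM (v := fun x => s * v x)
            (continuous_const.mul hv) fun x => mul_nonneg hs.le (hv0 x)]
          simp only [epairing_const_mul hs.le]
      _ ≤ ∫⁻ γ, {γ : Configuration d | epairing v γ ≠ ⊤}.indicator 1 γ ∂poissonMeasure z := by
          refine lintegral_mono fun γ => ?_
          by_cases h : epairing v γ = ⊤
          · simp [h, ENNReal.mul_top (ENNReal.ofReal_pos.2 hs).ne', expNeg_top]
          · rw [Set.indicator_of_mem (show γ ∈ {γ : Configuration d | epairing v γ ≠ ⊤} from h)]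
            exact expNeg_le_one _
      _ = _ := lintegral_indicator_one hm
  have hlim : Tendsto (fun n : ℕ => expNeg (ENNReal.ofReal (1 / ((n : ℝ) + 1)) * I)) atTop (𝓝 1) := by
    rw [← expNeg_zero]
    refine (continuous_expNeg.tendsto _).comp ?_
    have h := ENNReal.Tendsto.mul_const (b := I)
      ((ENNReal.continuous_ofReal.tendsto 0).comp
        (tendsto_one_div_add_atTop_nhds_zero_nat (𝕜 := ℝ))) (Or.inr hvz)
    simpa using h
  refine (mem_ae_iff_prob_eq_one hm).2 (le_antisymm prob_le_one (le_of_tendsto' hlim hle))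

end Poisson

/-! ### The number of jumps -/

/-- The number of renewals up to time `t` for given waiting times. -/
noncomputable def renewalCount (s : ℕ → ℝ) (t : ℝ≥0) : ℕ :=
  sInf {n : ℕ | (t : ℝ) < ∑ i ∈ Finset.range (n + 1), s i}

lemma measurable_renewalCount (t : ℝ≥0) : Measurable fun s : ℕ → ℝ => renewalCount s t := by
  have hA : ∀ n : ℕ, MeasurableSet {s : ℕ → ℝ | (t : ℝ) < ∑ i ∈ Finset.range (n + 1), s i} :=
    fun n => measurableSet_lt measurable_const (by fun_prop)
  refine measurable_of_Ici fun n => ?_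
  -- Because `sInf ∅ = 0`, a count of at least `n ≥ 1` also requires that some partial sum exceed
  -- `t`.
  have h : (fun s : ℕ → ℝ => renewalCount s t) ⁻¹' Set.Ici n =
      if n = 0 then Set.univ else
        (⋃ m, {s : ℕ → ℝ | (t : ℝ) < ∑ i ∈ Finset.range (m + 1), s i}) ∩
          ⋂ m, ⋂ (_ : m < n), {s : ℕ → ℝ | (t : ℝ) < ∑ i ∈ Finset.range (m + 1), s i}ᶜ := by
    split_ifs with hn
    · simp [hn, Set.Ici]
    · ext s
      simp only [Set.mem_preimage, Set.mem_Ici, Set.mem_inter_iff, Set.mem_iUnion, Set.mem_iInter,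
        Set.mem_compl_iff, Set.mem_ofPred_eq]
      constructor
      · intro h
        refine ⟨?_, fun m hm hm' => absurd ((Nat.sInf_le hm').trans_lt hm) (not_lt.2 h)⟩
        by_contra hne
        push Not at hne
        have : renewalCount s t = 0 := by
          rw [renewalCount, Nat.sInf_eq_zero]
          right
          ext m
          simpa using hne m
        omega
      · rintro ⟨⟨m, hm⟩, h⟩
        by_contra hlt
        exact h _ (not_le.1 hlt) (Nat.sInf_mem (s := {n : ℕ | (t : ℝ) <
          ∑ i ∈ Finset.range (n + 1), s i}) ⟨m, hm⟩)
  rw [h]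
  split_ifs
  · exact MeasurableSet.univ
  · exact (MeasurableSet.iUnion hA).inter
      (MeasurableSet.iInter fun m => MeasurableSet.iInter fun _ => (hA m).compl)

/-- Once `t` dominates the first `n` partial sums, none of the indices below `n` can be the count.
The hypothesis rules out the default value `0` of an infimum over the empty set. -/
lemma tendsto_renewalCount {s : ℕ → ℝ}
    (hs : ∀ T : ℕ, ∃ n, (T : ℝ) < ∑ i ∈ Finset.range (n + 1), s i) :
    Tendsto (fun t : ℝ≥0 => renewalCount s t) atTop atTop := by
  refine tendsto_atTop.2 fun n => ?_
  have h : ∀ᶠ t : ℝ≥0 in atTop, ∀ m ∈ Finset.range n,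
      ∑ i ∈ Finset.range (m + 1), s i ≤ t := by
    rw [Filter.eventually_all_finset]
    intro m _
    filter_upwards [eventually_ge_atTop (∑ i ∈ Finset.range (m + 1), s i).toNNReal] with t ht
    exact (Real.le_coe_toNNReal _).trans (NNReal.coe_le_coe.2 ht)
  filter_upwards [h] with t ht
  obtain ⟨T, hT⟩ := exists_nat_ge (t : ℝ)
  obtain ⟨k, hk⟩ := hs T
  by_contra hlt
  have h1 : (t : ℝ) < ∑ i ∈ Finset.range (renewalCount s t + 1), s i :=
    Nat.sInf_mem (s := {n : ℕ | (t : ℝ) < ∑ i ∈ Finset.range (n + 1), s i}) ⟨k, hT.trans_lt hk⟩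
  exact absurd h1 (not_lt.2 (ht _ (Finset.mem_range.2 (not_le.1 hlt))))

lemma lintegral_exp_neg_expMeasure_lt_one {r : ℝ} (hr : 0 < r) :
    ∫⁻ x, ENNReal.ofReal (Real.exp (-x)) ∂expMeasure r < 1 := by
  have := isProbabilityMeasure_expMeasure hr
  have h0 : expMeasure r (Set.Iic 0) = 0 := by
    have h := cdf_expMeasure_eq hr 0
    rw [cdf_eq_real] at h
    simpa [measureReal_eq_zero_iff] using h
  have hpos : ∀ᵐ x ∂expMeasure r, 0 < x := by
    filter_upwards [measure_eq_zero_iff_ae_notMem.1 h0] with x hx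
    simpa using hx
  have hlt : ∀ᵐ x ∂expMeasure r, ENNReal.ofReal (Real.exp (-x)) < 1 := by
    filter_upwards [hpos] with x hx
    rw [ENNReal.ofReal_lt_one]
    exact Real.exp_lt_one_iff.2 (by linarith)
  have hle : ∫⁻ x, ENNReal.ofReal (Real.exp (-x)) ∂expMeasure r ≤ ∫⁻ _, 1 ∂expMeasure r :=
    lintegral_mono_ae (hlt.mono fun x hx => hx.le)
  rw [lintegral_one, measure_univ] at hle
  have h := lintegral_strict_mono (IsProbabilityMeasure.ne_zero (expMeasure r))
    (g := fun _ => 1) aemeasurable_const (hle.trans_lt ENNReal.one_lt_top).ne hlt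
  simpa using h

/-- Chernoff's bound: a sum of `n + 1` waiting times is at most `T` with probability at most `e^T
c^(n+1)`, where `c < 1` is the expectation of `e^{-x}` for one waiting time. -/
lemma ae_exists_lt_sum_expMeasure {r : ℝ} (hr : 0 < r) :
    ∀ᵐ s ∂Measure.infinitePi (fun _ : ℕ => expMeasure r),
      ∀ T : ℕ, ∃ n, (T : ℝ) < ∑ i ∈ Finset.range (n + 1), s i := by
  have := isProbabilityMeasure_expMeasure hr
  refine ae_all_iff.2 fun T => ?_
  let c := ∫⁻ x, ENNReal.ofReal (Real.exp (-x)) ∂expMeasure r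
  have hle : ∀ n : ℕ, Measure.infinitePi (fun _ : ℕ => expMeasure r)
      {s | ¬ ∃ n, (T : ℝ) < ∑ i ∈ Finset.range (n + 1), s i} ≤
        ENNReal.ofReal (Real.exp T) * c ^ (n + 1) := by
    intro n
    have h1 : ∫⁻ s, ∏ i ∈ Finset.range (n + 1), ENNReal.ofReal (Real.exp (-s i))
        ∂Measure.infinitePi (fun _ : ℕ => expMeasure r) = c ^ (n + 1) := by
      rw [lintegral_infinitePi_prod (fun _ : ℕ => expMeasure r) (Finset.range (n + 1))
        (F := fun _ x => ENNReal.ofReal (Real.exp (-x))) fun _ => by fun_prop, Finset.prod_const,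
        Finset.card_range]
    rw [← h1, ← lintegral_const_mul _ (by fun_prop), ← setLIntegral_one]
    refine (setLIntegral_mono' ?_ fun s hs => ?_).trans (setLIntegral_le_lintegral _ _)
    · have hA : ∀ n : ℕ, MeasurableSet {s : ℕ → ℝ | (T : ℝ) < ∑ i ∈ Finset.range (n + 1), s i} :=
        fun n => measurableSet_lt measurable_const (by fun_prop)
      have := (MeasurableSet.iUnion hA).compl
      convert this using 1
      ext s
      simp
    · have hs' : ∑ i ∈ Finset.range (n + 1), s i ≤ T := not_lt.1 fun h => hs ⟨n, h⟩
      rw [← ENNReal.ofReal_prod_of_nonneg fun _ _ => (Real.exp_pos _).le, ← Real.exp_sum,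
        ← ENNReal.ofReal_mul (Real.exp_pos _).le, ← Real.exp_add, ENNReal.one_le_ofReal,
        Real.one_le_exp_iff, Finset.sum_neg_distrib]
      linarith
  have hlim : Tendsto (fun n : ℕ => ENNReal.ofReal (Real.exp T) * c ^ (n + 1)) atTop (𝓝 0) := by
    have h := (ENNReal.tendsto_pow_atTop_nhds_zero_of_lt_one
      (lintegral_exp_neg_expMeasure_lt_one hr)).comp (tendsto_add_atTop_nat 1)
    simpa using ENNReal.Tendsto.const_mul h (Or.inr ENNReal.ofReal_ne_top)
  exact le_antisymm (ge_of_tendsto' hlim hle) bot_le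

/-! ### The law of the displacement of a particle -/

/-- The displacement of a particle up to time `t`; the particle started at `x` is at
`x - displacement t w`. -/
noncomputable def displacement (t : ℝ≥0) (w : ParticleSpace d) : E d :=
  ∑ i ∈ Finset.range (jumpCount w t), w.1 i

lemma position_eq (x : E d) (w : ParticleSpace d) (t : ℝ≥0) :
    position x w t = x - displacement t w := rfl

lemma measurable_displacement (t : ℝ≥0) :
    Measurable fun w : ParticleSpace d => displacement t w := by
  have h : Measurable fun p : ℕ × (ℕ → E d) => ∑ i ∈ Finset.range p.1, p.2 i := by
    refine measurable_from_prod_countable_right fun n => ?_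
    dsimp only
    fun_prop
  exact h.comp (((measurable_renewalCount t).comp measurable_snd).prodMk measurable_fst)

section Particle

variable {a : E d → ℝ}

lemma isProbabilityMeasure_jumpLaw (ha0 : ∀ y, 0 ≤ a y)
    (hpos : 0 < totalRate a) : IsProbabilityMeasure (jumpLaw a) := by
  refine ⟨?_⟩
  have hi : Integrable a := by
    by_contra h
    rw [totalRate, integral_undef h] at hpos
    exact lt_irrefl _ hpos
  rw [jumpLaw, withDensity_apply _ MeasurableSet.univ, Measure.restrict_univ,
    ← ofReal_integral_eq_lintegral_ofReal (hi.div_const _)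
      (ae_of_all _ fun y => div_nonneg (ha0 y) hpos.le), integral_div]
  change ENNReal.ofReal (totalRate a / totalRate a) = 1
  rw [div_self hpos.ne', ENNReal.ofReal_one]

lemma isProbabilityMeasure_particleLaw (ha0 : ∀ y, 0 ≤ a y)
    (hpos : 0 < totalRate a) : IsProbabilityMeasure (particleLaw a) := by
  have := isProbabilityMeasure_jumpLaw ha0 hpos
  have := isProbabilityMeasure_expMeasure hpos
  unfold particleLaw
  infer_instance

/-- The law of the displacement of a particle up to time `t`. -/
noncomputable def displacementLaw (a : E d → ℝ) (t : ℝ≥0) : Measure (E d) :=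
  (particleLaw a).map (displacement t)

lemma isProbabilityMeasure_displacementLaw (ha0 : ∀ y, 0 ≤ a y)
    (hpos : 0 < totalRate a) (t : ℝ≥0) : IsProbabilityMeasure (displacementLaw a t) :=
  have := isProbabilityMeasure_particleLaw ha0 hpos
  Measure.isProbabilityMeasure_map (measurable_displacement t).aemeasurable

lemma jumpLaw_singleton (hd : 0 < d) (y : E d) : jumpLaw a {y} = 0 := by
  have : Nonempty (Fin d) := ⟨⟨0, hd⟩⟩
  exact withDensity_absolutelyContinuous _ _ (measure_singleton y)

/-- The last jump is independent of the others and its law has no atoms. -/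
lemma infinitePi_jumpLaw_sum_eq (hd : 0 < d) (ha0 : ∀ y, 0 ≤ a y)
    (hpos : 0 < totalRate a) (n : ℕ) (y : E d) :
    Measure.infinitePi (fun _ : ℕ => jumpLaw a) {w | ∑ i ∈ Finset.range (n + 1), w i = y} = 0 := by
  have := isProbabilityMeasure_jumpLaw ha0 hpos
  let P := Measure.infinitePi (fun _ : ℕ => jumpLaw a)
  have hind : iIndepFun (fun (i : ℕ) (w : ℕ → E d) => w i) P :=
    iIndepFun_infinitePi (X := fun _ x => x) fun _ => measurable_id
  have hi : IndepFun (fun w : ℕ → E d => ∑ i ∈ Finset.range n, w i) (fun w => w n) P := by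
    have := hind.indepFun_finsetSum_of_notMem (fun i => measurable_pi_apply i)
      (Finset.notMem_range_self (n := n))
    convert! this using 1
    ext w
    simp
  have hmap := (indepFun_iff_map_prod_eq_prod_map_map (by fun_prop)
    (measurable_pi_apply n).aemeasurable).1 hi
  rw [Measure.infinitePi_map_eval] at hmap
  have hS : MeasurableSet {p : E d × E d | p.1 + p.2 = y} :=
    measurableSet_eq_fun (by fun_prop) measurable_const
  have hP := Measure.map_apply (μ := P) (f := fun w : ℕ → E d => (∑ i ∈ Finset.range n, w i, w n))
    (by fun_prop) hS
  rw [hmap, Measure.prod_apply hS] at hP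
  have hz : ∀ x : E d, jumpLaw a (Prod.mk x ⁻¹' {p : E d × E d | p.1 + p.2 = y}) = 0 := by
    intro x
    refine Eq.trans ?_ (jumpLaw_singleton (a := a) hd (y - x))
    congr 1
    ext b
    simp [eq_sub_iff_add_eq']
  simp only [hz, lintegral_zero] at hP
  rw [hP]
  congr 1
  ext w
  simp [Finset.sum_range_succ]

/-- The displacement has no atom except possibly at the origin. -/
lemma particleLaw_displacement_eq (hd : 0 < d) (ha0 : ∀ y, 0 ≤ a y)
    (hpos : 0 < totalRate a) (t : ℝ≥0) {y : E d} (hy : y ≠ 0) :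
    particleLaw a (displacement t ⁻¹' {y}) = 0 := by
  have := isProbabilityMeasure_jumpLaw ha0 hpos
  have := isProbabilityMeasure_expMeasure hpos
  have h : displacement t ⁻¹' {y} ⊆ ⋃ n : ℕ,
      (Prod.fst : ParticleSpace d → ℕ → E d) ⁻¹' {w | ∑ i ∈ Finset.range (n + 1), w i = y} := by
    intro w hw
    have hw' : ∑ i ∈ Finset.range (jumpCount w t), w.1 i = y := hw
    -- Without a jump the displacement is `0 ≠ y`; otherwise it is a sum of at least one jump.
    rcases Nat.eq_zero_or_eq_succ_pred (jumpCount w t) with h0 | h1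
    · rw [h0] at hw'
      exact absurd hw'.symm hy
    · rw [h1] at hw'
      exact Set.mem_iUnion.2 ⟨_, hw'⟩
  refine measure_mono_null h (measure_iUnion_null fun n => ?_)
  rw [particleLaw, measurePreserving_fst.measure_preimage
    (measurableSet_eq_fun (by fun_prop) measurable_const).nullMeasurableSet]
  exact infinitePi_jumpLaw_sum_eq hd ha0 hpos n y

end Particle

end FreeKawasaki

namespace FreeKawasaki

variable {d : ℕ} {a : E d → ℝ}

/-! ### Decay of the characteristic function of the displacement -/

/-- The set is empty or, given one of its points `x₀`, contained in the countably many parallel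
hyperplanes `⟨x, k⟩ = ⟨x₀, k⟩ + 2πn`, which are null sets. -/
lemma volume_exp_inner_eq (c : ℂ) {k : E d} (hk : k ≠ 0) :
    volume {x : E d | Complex.exp (inner ℝ x k * Complex.I) = c} = 0 := by
  rcases Set.eq_empty_or_nonempty {x : E d | Complex.exp (inner ℝ x k * Complex.I) = c} with h | h
  · rw [h, measure_empty]
  obtain ⟨x₀, hx₀⟩ := h
  have hsub : {x : E d | Complex.exp (inner ℝ x k * Complex.I) = c} ⊆
      ⋃ n : ℤ, {x : E d | inner ℝ x k = inner ℝ x₀ k + n * (2 * Real.pi)} := by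
    intro x hx
    have hx' : Complex.exp (inner ℝ x k * Complex.I) = Complex.exp (inner ℝ x₀ k * Complex.I) :=
      Eq.trans hx hx₀.symm
    obtain ⟨n, hn⟩ := Complex.exp_eq_exp_iff_exists_int.1 hx'
    refine Set.mem_iUnion.2 ⟨n, ?_⟩
    have h2 := congrArg Complex.im hn
    simpa using h2
  refine measure_mono_null hsub (measure_iUnion_null fun n => ?_)
  set b := inner ℝ x₀ k + n * (2 * Real.pi)
  rcases Set.eq_empty_or_nonempty {x : E d | inner ℝ x k = b} with h | ⟨y, hy⟩
  · rw [h, measure_empty]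
  let p : Submodule ℝ (E d) := LinearMap.ker (innerSL ℝ k).toLinearMap
  have hp : p ≠ ⊤ := by
    intro htop
    have : k ∈ p := htop ▸ Submodule.mem_top
    have h0 : inner ℝ k k = 0 := this
    exact hk (inner_self_eq_zero.1 h0)
  have h0 := Measure.addHaar_submodule volume p hp
  have heq : {x : E d | inner ℝ x k = b} = (fun x => x - y) ⁻¹' (p : Set (E d)) := by
    ext x
    have hy' : inner ℝ y k = b := hy
    change inner ℝ x k = b ↔ inner ℝ k (x - y) = 0
    rw [real_inner_comm (x - y) k, inner_sub_left, hy', sub_eq_zero]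
  rw [heq, (measurePreserving_sub_right volume y).measure_preimage
    p.closed_of_finiteDimensional.measurableSet.nullMeasurableSet, h0]

/-- Equality in the triangle inequality would force `e^{i⟨x, k⟩}` to be almost surely constant,
which an absolutely continuous jump law forbids. -/
lemma norm_charFun_jumpLaw_lt_one (ha0 : ∀ y, 0 ≤ a y) (hpos : 0 < totalRate a) {k : E d}
    (hk : k ≠ 0) : ‖charFun (jumpLaw a) k‖ < 1 := by
  have := isProbabilityMeasure_jumpLaw ha0 hpos
  have h := ae_eq_const_or_norm_integral_lt_of_norm_le_const (μ := jumpLaw a)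
    (f := fun x => Complex.exp (inner ℝ x k * Complex.I)) (C := 1)
    (ae_of_all _ fun x => (Complex.norm_exp_ofReal_mul_I _).le)
  rcases h with h | h
  · exfalso
    have h0 : jumpLaw a {x : E d | Complex.exp (inner ℝ x k * Complex.I) =
        ⨍ x, Complex.exp (inner ℝ x k * Complex.I) ∂jumpLaw a} = 0 :=
      withDensity_absolutelyContinuous _ _ (volume_exp_inner_eq _ hk)
    have h1 := measure_eq_zero_iff_ae_notMem.1 h0
    obtain ⟨x, hx, hx'⟩ := (h.and h1).exists
    exact hx' hx
  · rw [charFun_apply]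
    simpa using h

lemma integral_exp_sum_jumpLaw (ha0 : ∀ y, 0 ≤ a y) (hpos : 0 < totalRate a) (k : E d) (n : ℕ) :
    ∫ w, Complex.exp (inner ℝ (∑ i ∈ Finset.range n, w i) k * Complex.I)
      ∂Measure.infinitePi (fun _ : ℕ => jumpLaw a) = charFun (jumpLaw a) k ^ n := by
  have := isProbabilityMeasure_jumpLaw ha0 hpos
  have hind : iIndepFun (fun (i : ℕ) (w : ℕ → E d) => w i)
      (Measure.infinitePi (fun _ : ℕ => jumpLaw a)) :=
    iIndepFun_infinitePi (X := fun _ x => x) fun _ => measurable_id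
  have h := (hind.restrict (Finset.range n)).charFun_map_fun_finsetSum_eq_prod
    fun i _ => (measurable_pi_apply i).aemeasurable
  have h2 := congrFun h k
  rw [charFun_apply, integral_map (Measurable.aemeasurable (by fun_prop)) (by fun_prop)] at h2
  rw [h2, Finset.prod_apply]
  simp [Measure.infinitePi_map_eval]

/-- The law of the displacement spreads out: its characteristic function converges to zero away
from the origin. -/
theorem tendsto_charFun_displacementLaw (ha0 : ∀ y, 0 ≤ a y) (hpos : 0 < totalRate a) {k : E d}
    (hk : k ≠ 0) : Tendsto (fun t : ℝ≥0 => charFun (displacementLaw a t) k) atTop (𝓝 0) := by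
  have := isProbabilityMeasure_jumpLaw ha0 hpos
  have := isProbabilityMeasure_expMeasure hpos
  have hP := isProbabilityMeasure_particleLaw ha0 hpos
  set q := charFun (jumpLaw a) k
  have hq : ‖q‖ < 1 := norm_charFun_jumpLaw_lt_one ha0 hpos hk
  -- For fixed waiting times the displacement is a sum of a fixed number of independent jumps.
  have heq : ∀ t : ℝ≥0, charFun (displacementLaw a t) k =
      ∫ s, q ^ renewalCount s t ∂Measure.infinitePi (fun _ : ℕ => expMeasure (totalRate a)) := by
    intro t
    have hm : Measurable fun w : ParticleSpace d =>
        Complex.exp (inner ℝ (displacement t w) k * Complex.I) := by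
      have := measurable_displacement (d := d) t
      fun_prop
    rw [charFun_apply, displacementLaw, integral_map (measurable_displacement t).aemeasurable
      (by fun_prop), particleLaw, integral_prod_symm _ ?_]
    · refine integral_congr_ae (ae_of_all _ fun s => ?_)
      exact integral_exp_sum_jumpLaw ha0 hpos k (renewalCount s t)
    · refine Integrable.of_bound hm.aestronglyMeasurable 1 (ae_of_all _ fun w => ?_)
      exact (Complex.norm_exp_ofReal_mul_I _).le
  simp only [heq]
  have h0 : ∫ _, (0 : ℂ) ∂Measure.infinitePi (fun _ : ℕ => expMeasure (totalRate a)) = 0 := by simp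
  rw [← h0]
  refine tendsto_integral_filter_of_dominated_convergence (fun _ => 1)
    (Eventually.of_forall fun t => ?_) (Eventually.of_forall fun t => ae_of_all _ fun s => ?_)
    (integrable_const _) ?_
  · exact (measurable_from_top (f := fun n : ℕ => q ^ n) |>.comp
      (measurable_renewalCount t)).aestronglyMeasurable
  · rw [norm_pow]
    exact pow_le_one₀ (norm_nonneg _) hq.le
  · filter_upwards [ae_exists_lt_sum_expMeasure hpos] with s hs
    exact (tendsto_pow_atTop_nhds_zero_of_norm_lt_one hq).comp (tendsto_renewalCount hs)

end FreeKawasaki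

namespace FreeKawasaki

variable {d : ℕ}

/-! ### Smoothing functions whose Fourier transform is a measure -/

/-- The average `∫ g(x - s) κ(ds)`. -/
noncomputable def smear (κ : Measure (E d)) (g : E d → ℝ) (x : E d) : ℝ := ∫ s, g (x - s) ∂κ

lemma integrable_comp_sub (κ : Measure (E d)) [IsProbabilityMeasure κ] {g : E d → ℝ}
    (hg : Continuous g) {B : ℝ} (hB : ∀ x, ‖g x‖ ≤ B) (x : E d) :
    Integrable (fun s => g (x - s)) κ :=
  Integrable.of_bound (hg.comp (continuous_const.sub continuous_id)).aestronglyMeasurable B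
    (ae_of_all _ fun _ => hB _)

lemma continuous_smear (κ : Measure (E d)) [IsProbabilityMeasure κ] {g : E d → ℝ}
    (hg : Continuous g) {B : ℝ} (hB : ∀ x, ‖g x‖ ≤ B) : Continuous (smear κ g) :=
  continuous_of_dominated
    (fun _ => (hg.comp (continuous_const.sub continuous_id)).aestronglyMeasurable)
    (fun _ => ae_of_all _ fun _ => hB _) (integrable_const B)
    (ae_of_all _ fun _ => hg.comp (continuous_id.sub continuous_const))

/-- The functions `(s, x) ↦ g(x - s) z(x)` with integrable `g` and bounded `z` are integrable. -/
lemma integrable_comp_sub_mul (κ : Measure (E d)) [IsProbabilityMeasure κ] {g : E d → ℝ}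
    (hg : Continuous g) (hi : Integrable g) {z : E d → ℝ} (hz : Measurable z) {M : ℝ}
    (hM : ∀ x, ‖z x‖ ≤ M) :
    Integrable (fun p : E d × E d => g (p.2 - p.1) * z p.2) (κ.prod volume) := by
  have h : Integrable (fun p : E d × E d => g (p.2 - p.1)) (κ.prod volume) := by
    have hm : AEStronglyMeasurable (fun p : E d × E d => g (p.2 - p.1)) (κ.prod volume) :=
      (hg.comp (continuous_snd.sub continuous_fst)).aestronglyMeasurable
    refine (integrable_prod_iff hm).2 ⟨ae_of_all _ fun s => hi.comp_sub_right s, ?_⟩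
    have : ∀ s : E d, ∫ x, ‖g (x - s)‖ = ∫ x, ‖g x‖ := fun s =>
      integral_sub_right_eq_self (fun x => ‖g x‖) s
    simp only [this]
    exact integrable_const _
  exact h.mul_bdd (c := M) (hz.comp measurable_snd).aestronglyMeasurable (ae_of_all _ fun _ => hM _)

lemma integral_smear_mul (κ : Measure (E d)) [IsProbabilityMeasure κ] {g : E d → ℝ}
    (hg : Continuous g) (hi : Integrable g) {z : E d → ℝ} (hz : Measurable z) {M : ℝ}
    (hM : ∀ x, ‖z x‖ ≤ M) :
    ∫ x, smear κ g x * z x = ∫ s, (∫ x, g (x - s) * z x) ∂κ := by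
  rw [integral_integral_swap (f := fun s x => g (x - s) * z x)
    (integrable_comp_sub_mul κ hg hi hz hM)]
  exact integral_congr_ae (ae_of_all _ fun x => (integral_mul_const (z x) _).symm)

lemma integrable_smear_mul (κ : Measure (E d)) [IsProbabilityMeasure κ] {g : E d → ℝ}
    (hg : Continuous g) (hi : Integrable g) {z : E d → ℝ} (hz : Measurable z) {M : ℝ}
    (hM : ∀ x, ‖z x‖ ≤ M) : Integrable fun x => smear κ g x * z x := by
  refine (integrable_comp_sub_mul κ hg hi hz hM).integral_prod_right.congr
    (ae_of_all _ fun x => integral_mul_const (z x) _)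

/-- Translation becomes modulation. The factor `2π` reconciles the normalization of `𝓕` with that of
`charFun`. -/
lemma fourierInv_comp_sub (g : 𝓢(E d, ℂ)) (s k : E d) :
    (𝓕⁻ (g.compSubConstCLM ℂ s)) k =
      Complex.exp (inner ℝ s ((2 * Real.pi) • k) * Complex.I) * (𝓕⁻ g) k := by
  rw [SchwartzMap.fourierInv_coe, SchwartzMap.fourierInv_coe, Real.fourierInv_eq',
    Real.fourierInv_eq', ← integral_const_mul, ← integral_add_right_eq_self _ s]
  refine integral_congr_ae (ae_of_all _ fun x => ?_)
  simp only [SchwartzMap.compSubConstCLM_apply, add_sub_cancel_right, smul_eq_mul, inner_add_left,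
    inner_smul_right, ← mul_assoc, ← Complex.exp_add]
  congr 2
  push_cast
  ring

/-- A Schwartz function given by a smooth compactly supported real function. -/
noncomputable def toSchwartz {g : E d → ℝ} (hg : ContDiff ℝ ∞ g) (hc : HasCompactSupport g) :
    𝓢(E d, ℂ) :=
  HasCompactSupport.toSchwartzMap (f := fun x => (g x : ℂ))
    (hc.comp_left (g := fun r : ℝ => (r : ℂ)) Complex.ofReal_zero)
    (Complex.ofRealCLM.contDiff.comp hg)

lemma toSchwartz_apply {g : E d → ℝ} (hg : ContDiff ℝ ∞ g) (hc : HasCompactSupport g) (x : E d) :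
    toSchwartz hg hc x = g x := rfl

/-! ### Averages of `z` expressed through its Fourier transform -/

section Fourier

variable {z : E d → ℝ} {ν : Measure (E d)} {h : E d → ℂ}

/-- A cutoff is integrable and equals one on a given ball, so balls have finite measure. This makes
Fubini's theorem available for `ν`. -/
lemma sigmaFinite_of_integrable_schwartz (hν : ∀ φ : 𝓢(E d, ℂ), Integrable φ ν) :
    SigmaFinite ν := by
  have : IsLocallyFiniteMeasure ν := by
    refine ⟨fun x => ?_⟩
    obtain ⟨n, hn⟩ := exists_nat_gt ‖x‖
    refine ⟨Metric.ball 0 n, Metric.isOpen_ball.mem_nhds (by simpa using hn), ?_⟩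
    have hi := hν (toSchwartz (cutoff d n).contDiff (cutoff d n).hasCompactSupport)
    have h1 := hi.norm.measure_ge_lt_top (ε := 1) one_pos
    refine (measure_mono fun y hy => ?_).trans_lt h1
    have hy' : ‖y‖ < n := by simpa using hy
    change (1 : ℝ) ≤ ‖(cutoff d n y : ℂ)‖
    rw [cutoff_eq_one (by linarith)]
    simp
  infer_instance

/-- The identity defining `ẑ`, applied to the inverse Fourier transform of the translate `g(· - s)`,
expresses `∫ g(x - s) z(x) dx` with a phase `e^{2πi⟨s, k⟩}`. Integrating this phase over `κ(ds)`
yields the characteristic function. -/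
lemma integral_smear_eq_integral_charFun (hz : Measurable z) {M : ℝ} (hM : ∀ x, ‖z x‖ ≤ M)
    (hh : Measurable h) (hh1 : ∀ k, ‖h k‖ = 1)
    (hν : ∀ φ : 𝓢(E d, ℂ), Integrable (fun k => φ k) ν ∧
      ∫ k, φ k * h k ∂ν = ∫ x, (𝓕 φ) x * (z x : ℂ))
    {g : E d → ℝ} (hg : ContDiff ℝ ∞ g) (hc : HasCompactSupport g)
    (κ : Measure (E d)) [IsProbabilityMeasure κ] :
    ((∫ x, smear κ g x * z x : ℝ) : ℂ) =
      ∫ k, (𝓕⁻ (toSchwartz hg hc)) k * h k * charFun κ ((2 * Real.pi) • k) ∂ν := by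
  have := sigmaFinite_of_integrable_schwartz fun φ => (hν φ).1
  set G := 𝓕⁻ (toSchwartz hg hc)
  rw [integral_smear_mul κ hg.continuous (hg.continuous.integrable_of_hasCompactSupport hc) hz hM,
    ← integral_complex_ofReal]
  have h1 : ∀ s, ((∫ x, g (x - s) * z x : ℝ) : ℂ) =
      ∫ k, Complex.exp (inner ℝ s ((2 * Real.pi) • k) * Complex.I) * (G k * h k) ∂ν := by
    intro s
    have h2 := (hν (𝓕⁻ ((toSchwartz hg hc).compSubConstCLM ℂ s))).2
    rw [FourierTransform.fourier_fourierInv_eq] at h2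
    simp only [fourierInv_comp_sub, SchwartzMap.compSubConstCLM_apply, toSchwartz_apply] at h2
    rw [← integral_complex_ofReal]
    push_cast
    rw [← h2]
    exact integral_congr_ae (ae_of_all _ fun k => mul_assoc _ _ _)
  simp only [h1]
  rw [integral_integral_swap]
  · refine integral_congr_ae (ae_of_all _ fun k => ?_)
    simp only [integral_mul_const, charFun_apply]
    rw [mul_comm]
  · have hG : Integrable (fun k => G k * h k) ν :=
      (hν G).1.mul_bdd (c := 1) hh.aestronglyMeasurable (ae_of_all _ fun k => (hh1 k).le)
    have hG2 : Integrable (fun p : E d × E d => G p.2 * h p.2) (κ.prod ν) := hG.comp_snd κ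
    refine hG2.bdd_mul (c := 1) ?_ (ae_of_all _ fun p => ?_)
    · refine Continuous.aestronglyMeasurable ?_
      fun_prop
    · exact (Complex.norm_exp_ofReal_mul_I _).le

/-- If the Fourier transform of `z` is a measure, then the averages of `z` over probability
measures that spread out converge. -/
theorem FourierTransformIsMeasure.exists_tendsto (hz : Measurable z) {M : ℝ}
    (hM : ∀ x, ‖z x‖ ≤ M) (hF : FourierTransformIsMeasure z) :
    ∃ m : ℝ, ∀ (ι : Type) (l : Filter ι) [l.IsCountablyGenerated] (κ : ι → Measure (E d)),
      (∀ i, IsProbabilityMeasure (κ i)) →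
      (∀ k ≠ 0, Tendsto (fun i => charFun (κ i) k) l (𝓝 0)) →
      ∀ g : E d → ℝ, ContDiff ℝ ∞ g → HasCompactSupport g →
        Tendsto (fun i => ∫ x, smear (κ i) g x * z x) l (𝓝 (m * ∫ x, g x)) := by
  obtain ⟨ν, h, hh, hh1, hν⟩ := hF
  -- The constant is the atom `ẑ({0})`. Taking its real part is harmless, as the integrals and `∫ g`
  -- are real.
  refine ⟨((ν.real {0} : ℂ) * h 0).re, fun ι l _ κ hκ hlim g hg hc => ?_⟩
  set G := 𝓕⁻ (toSchwartz hg hc) with hGdef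
  have hG0 : G 0 = ((∫ x, g x : ℝ) : ℂ) := by
    rw [hGdef, SchwartzMap.fourierInv_coe, Real.fourierInv_eq', ← integral_complex_ofReal]
    simp [toSchwartz_apply]
  have h1 : Tendsto (fun i => ((∫ x, smear (κ i) g x * z x : ℝ) : ℂ)) l
      (𝓝 (∫ k, ({0} : Set (E d)).indicator (fun _ => G 0 * h 0) k ∂ν)) := by
    simp only [fun i => integral_smear_eq_integral_charFun hz hM hh hh1 hν hg hc (κ i)]
    refine tendsto_integral_filter_of_dominated_convergence (fun k => ‖G k‖)
      (Eventually.of_forall fun i => ?_) (Eventually.of_forall fun i => ae_of_all _ fun k => ?_)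
      (hν G).1.norm (ae_of_all _ fun k => ?_)
    · refine ((hν G).1.aestronglyMeasurable.mul hh.aestronglyMeasurable).mul ?_
      exact (measurable_charFun.comp (measurable_const_smul _)).aestronglyMeasurable
    · rw [norm_mul, norm_mul, hh1, mul_one]
      exact mul_le_of_le_one_right (norm_nonneg _) (norm_charFun_le_one _)
    · by_cases hk : k = 0
      · subst hk
        rw [Set.indicator_of_mem (Set.mem_singleton 0)]
        refine tendsto_const_nhds.congr fun i => ?_
        simp [G]
      · rw [Set.indicator_of_notMem (by simpa using hk)]
        have := (hlim ((2 * Real.pi) • k) (smul_ne_zero (by positivity) hk)).const_mul (G k * h k)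
        simpa using this
  rw [integral_indicator_const _ (measurableSet_singleton 0)] at h1
  have h2 := (Complex.continuous_re.tendsto _).comp h1
  convert! h2 using 2
  rw [hG0, Complex.real_smul]
  simp only [Complex.mul_re, Complex.ofReal_re, Complex.ofReal_im]
  ring

end Fourier

/-! ### The arithmetic mean -/

/-- The uniform law on the closed ball of radius `R` centred at the origin. -/
noncomputable def ballLaw (d : ℕ) (R : ℝ) : Measure (E d) :=
  (volume (Metric.closedBall (0 : E d) R))⁻¹ • volume.restrict (Metric.closedBall 0 R)

/-- The volume of the closed ball of radius `R`. -/
noncomputable def ballVol (d : ℕ) (R : ℝ) : ℝ := volume.real (Metric.closedBall (0 : E d) R)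

lemma ballVol_eq {R : ℝ} (hR : 0 ≤ R) : ballVol d R = R ^ d * ballVol d 1 := by
  rw [ballVol, Measure.addHaar_real_closedBall' _ _ hR, finrank_euclideanSpace_fin]
  rfl

lemma ballVol_pos {R : ℝ} (hR : 0 < R) : 0 < ballVol d R :=
  ENNReal.toReal_pos (Metric.measure_closedBall_pos _ _ hR).ne' measure_closedBall_lt_top.ne

lemma isProbabilityMeasure_ballLaw {R : ℝ} (hR : 0 < R) : IsProbabilityMeasure (ballLaw d R) := by
  refine ⟨?_⟩
  rw [ballLaw, Measure.smul_apply, Measure.restrict_apply_univ, smul_eq_mul]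
  exact ENNReal.inv_mul_cancel (Metric.measure_closedBall_pos _ _ hR).ne'
    measure_closedBall_lt_top.ne

lemma integral_ballLaw {F : Type*} [NormedAddCommGroup F] [NormedSpace ℝ F] (f : E d → F) (R : ℝ) :
    ∫ x, f x ∂ballLaw d R = (ballVol d R)⁻¹ • ∫ x in Metric.closedBall 0 R, f x := by
  rw [ballLaw, integral_smul_measure, ENNReal.toReal_inv]
  rfl

lemma charFun_ballLaw {R : ℝ} (hR : 0 < R) (k : E d) :
    charFun (ballLaw d R) k =
      (ballVol d 1)⁻¹ • ∫ x in Metric.closedBall (0 : E d) 1,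
        Complex.exp (inner ℝ x (R • k) * Complex.I) := by
  have h := Measure.setIntegral_comp_smul_of_pos volume
    (fun x : E d => Complex.exp (inner ℝ x k * Complex.I)) (Metric.closedBall 0 1) hR
  rw [smul_unitClosedBall_of_nonneg hR.le, finrank_euclideanSpace_fin] at h
  simp only [inner_smul_left, inner_smul_right, conj_trivial] at h ⊢
  rw [charFun_apply, integral_ballLaw, h, ballVol_eq hR.le, smul_smul, mul_inv, mul_comm]

/-- After rescaling to the unit ball, this is the Riemann–Lebesgue lemma for the indicator of that
ball. -/
lemma tendsto_charFun_ballLaw {k : E d} (hk : k ≠ 0) :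
    Tendsto (fun R : ℝ => charFun (ballLaw d R) k) atTop (𝓝 0) := by
  have h1 := tendsto_integral_exp_inner_smul_cocompact
    ((Metric.closedBall (0 : E d) 1).indicator fun _ => (1 : ℂ))
  -- The frequency `-(R / 2π) k` turns the kernel `e^{-2πi⟨x, ·⟩}` into `e^{iR⟨x, k⟩}`.
  have h2 : Tendsto (fun R : ℝ => (-(R / (2 * Real.pi))) • k) atTop (cocompact (E d)) := by
    rw [← Metric.cobounded_eq_cocompact, ← tendsto_norm_atTop_iff_cobounded]
    have h3 : Tendsto (fun R : ℝ => R * (‖k‖ / (2 * Real.pi))) atTop atTop :=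
      tendsto_id.atTop_mul_const (by have := norm_pos_iff.2 hk; positivity)
    refine h3.congr' ?_
    filter_upwards [eventually_ge_atTop 0] with R hR
    rw [norm_smul, norm_neg, Real.norm_of_nonneg (by positivity)]
    ring
  have h4 := (h1.comp h2).const_smul (ballVol d 1)⁻¹
  rw [smul_zero] at h4
  refine h4.congr' ?_
  filter_upwards [eventually_gt_atTop 0] with R hR
  rw [charFun_ballLaw hR, Function.comp_apply, ← integral_indicator measurableSet_closedBall]
  congr 2
  funext x
  by_cases hx : x ∈ Metric.closedBall (0 : E d) 1
  · rw [Set.indicator_of_mem hx, Set.indicator_of_mem hx, Circle.smul_def, smul_eq_mul, mul_one,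
      Real.fourierChar_apply]
    congr 2
    rw [inner_smul_right, inner_smul_right]
    norm_cast
    field_simp
  · rw [Set.indicator_of_notMem hx, Set.indicator_of_notMem hx, smul_zero]

lemma tendsto_ballVol_add_div (c : ℝ) :
    Tendsto (fun R : ℝ => ballVol d (R + c) / ballVol d R) atTop (𝓝 1) := by
  have h1 : Tendsto (fun R : ℝ => (1 + c / R) ^ d) atTop (𝓝 1) := by
    have := ((tendsto_const_nhds (x := c)).div_atTop tendsto_id).const_add 1 |>.pow d
    simpa using this
  refine h1.congr' ?_
  filter_upwards [eventually_gt_atTop 0, eventually_ge_atTop (-c)] with R hR hRc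
  have hV := ballVol_pos (d := d) one_pos
  rw [ballVol_eq (by linarith), ballVol_eq hR.le, mul_div_mul_right _ _ hV.ne', ← div_pow]
  congr 1
  field_simp

/-- The indicator of a ball is bounded above by a multiple of the smearing over a larger ball. -/
lemma indicator_le_smear {f : E d → ℝ} (hf : IsTest f) (hf1 : ∫ x, f x = 1) {r : ℝ}
    (hr : ∀ x, f x ≠ 0 → ‖x‖ ≤ r) {R : ℝ} (hR : 0 < R + r) (x : E d) :
    (Metric.closedBall (0 : E d) R).indicator 1 x ≤
      ballVol d (R + r) * smear (ballLaw d (R + r)) f x := by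
  rw [smear, integral_ballLaw, smul_eq_mul, mul_inv_cancel_left₀ (ballVol_pos hR).ne']
  by_cases hx : x ∈ Metric.closedBall (0 : E d) R
  · rw [Set.indicator_of_mem hx, Pi.one_apply, setIntegral_eq_integral_of_forall_compl_eq_zero,
      integral_sub_left_eq_self, hf1]
    intro s hs
    by_contra h
    refine hs ?_
    have h1 := hr _ h
    have h2 : ‖x‖ ≤ R := by simpa using hx
    have h3 : ‖s‖ ≤ ‖x‖ + ‖x - s‖ := by
      rw [norm_sub_rev]
      exact norm_le_norm_add_norm_sub' _ _
    simpa using h3.trans (add_le_add h2 h1)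
  · rw [Set.indicator_of_notMem hx]
    exact integral_nonneg fun s => hf.nonneg _

/-- A point within `r` of the smaller ball lies in the ball of radius `R`, and `f` has total mass
one. This is the lower half of the sandwich. -/
lemma smear_le_indicator {f : E d → ℝ} (hf : IsTest f) (hf1 : ∫ x, f x = 1) {r : ℝ}
    (hr : ∀ x, f x ≠ 0 → ‖x‖ ≤ r) {R : ℝ} (hR : 0 < R - r) (x : E d) :
    ballVol d (R - r) * smear (ballLaw d (R - r)) f x ≤
      (Metric.closedBall (0 : E d) R).indicator 1 x := by
  rw [smear, integral_ballLaw, smul_eq_mul, mul_inv_cancel_left₀ (ballVol_pos hR).ne']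
  by_cases hx : x ∈ Metric.closedBall (0 : E d) R
  · rw [Set.indicator_of_mem hx, Pi.one_apply, ← hf1, ← integral_sub_left_eq_self f volume x]
    have hi : Integrable f := hf.continuous.integrable_of_hasCompactSupport hf.compact
    exact setIntegral_le_integral (hi.comp_sub_left x) (ae_of_all _ fun s => hf.nonneg _)
  · rw [Set.indicator_of_notMem hx]
    refine (setIntegral_eq_zero_of_forall_eq_zero fun s hs => ?_).le
    by_contra h
    refine hx ?_
    have h1 := hr _ h
    have h2 : ‖s‖ ≤ R - r := by simpa using hs
    have h3 : ‖x‖ ≤ ‖s‖ + ‖x - s‖ := norm_le_norm_add_norm_sub' _ _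
    simpa using h3.trans (add_le_add h2 h1)

/-- If the averages of `z` over the smeared balls converge, then `z` has an arithmetic mean. -/
theorem hasArithmeticMean_of_tendsto {z : E d → ℝ} (hz : Measurable z) (hz0 : ∀ x, 0 ≤ z x) {M : ℝ}
    (hM : ∀ x, z x ≤ M) {m : ℝ}
    (h : ∀ f : E d → ℝ, IsTest f →
      Tendsto (fun R : ℝ => ∫ x, smear (ballLaw d R) f x * z x) atTop (𝓝 (m * ∫ x, f x))) :
    HasArithmeticMean z m := by
  have hzM : ∀ x, ‖z x‖ ≤ M := fun x => by rw [Real.norm_of_nonneg (hz0 x)]; exact hM x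
  let b := cutoff d 0
  let f : E d → ℝ := b.normed volume
  have hf : IsTest f := ⟨b.contDiff_normed (n := ⊤), b.hasCompactSupport_normed, b.nonneg_normed⟩
  have hf1 : ∫ x, f x = 1 := b.integral_normed
  obtain ⟨r, hr'⟩ := exists_norm_lt_of_ne_zero hf.compact
  have hr : ∀ x, f x ≠ 0 → ‖x‖ ≤ r := fun x hx => (hr' x hx).le
  let I : ℝ → ℝ := fun R => ∫ x, smear (ballLaw d R) f x * z x
  have hI : Tendsto I atTop (𝓝 m) := by simpa [hf1] using h f hf
  have hint : ∀ R : ℝ, 0 < R → Integrable fun x => smear (ballLaw d R) f x * z x := fun R hR =>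
    have := isProbabilityMeasure_ballLaw (d := d) hR
    integrable_smear_mul _ hf.continuous
      (hf.continuous.integrable_of_hasCompactSupport hf.compact) hz hzM
  have hzint : ∀ R : ℝ, IntegrableOn z (Metric.closedBall 0 R) := fun R =>
    Measure.integrableOn_of_bounded measure_closedBall_lt_top.ne hz.aestronglyMeasurable
      (M := M) (ae_of_all _ hzM)
  have hind : ∀ R : ℝ, ∫ x in Metric.closedBall 0 R, z x =
      ∫ x, (Metric.closedBall (0 : E d) R).indicator 1 x * z x := fun R => by
    rw [← integral_indicator measurableSet_closedBall]
    refine integral_congr_ae (ae_of_all _ fun x => ?_)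
    by_cases hx : x ∈ Metric.closedBall (0 : E d) R
    · simp [Set.indicator_of_mem hx]
    · simp [Set.indicator_of_notMem hx]
  have hindint : ∀ R : ℝ,
      Integrable fun x => (Metric.closedBall (0 : E d) R).indicator 1 x * z x := fun R => by
    refine ((hzint R).integrable_indicator measurableSet_closedBall).congr (ae_of_all _ fun x => ?_)
    by_cases hx : x ∈ Metric.closedBall (0 : E d) R
    · simp [Set.indicator_of_mem hx]
    · simp [Set.indicator_of_notMem hx]
  -- The average over `B(R)` is squeezed between smeared averages over `B(R - r)` and `B(R + r)`,
  -- weighted by volume ratios that tend to one. The sign of `z` makes the pointwise bounds survive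
  -- integration.
  have hup : Tendsto (fun R : ℝ => ballVol d (R + r) / ballVol d R * I (R + r)) atTop (𝓝 m) := by
    have := (tendsto_ballVol_add_div (d := d) r).mul
      (hI.comp (tendsto_atTop_add_const_right _ (r : ℝ) tendsto_id))
    simpa using this
  have hlow : Tendsto (fun R : ℝ => ballVol d (R - r) / ballVol d R * I (R - r)) atTop (𝓝 m) := by
    have := (tendsto_ballVol_add_div (d := d) (-r)).mul
      (hI.comp (tendsto_atTop_add_const_right _ (-r : ℝ) tendsto_id))
    simpa [sub_eq_add_neg] using this
  refine tendsto_of_tendsto_of_tendsto_of_le_of_le' hlow hup ?_ ?_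
  · filter_upwards [eventually_gt_atTop (r : ℝ)] with R hR
    have hR0 : 0 < R := (Nat.cast_nonneg r).trans_lt hR
    rw [setAverage_eq, smul_eq_mul, hind, div_mul_eq_mul_div, ← integral_const_mul,
      div_eq_inv_mul]
    refine mul_le_mul_of_nonneg_left ?_ (inv_nonneg.2 (ballVol_pos hR0).le)
    refine integral_mono ((hint _ (sub_pos.2 hR)).const_mul _) (hindint R) fun x => ?_
    dsimp only
    rw [← mul_assoc]
    exact mul_le_mul_of_nonneg_right (smear_le_indicator hf hf1 hr (sub_pos.2 hR) x) (hz0 x)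
  · filter_upwards [eventually_gt_atTop (0 : ℝ)] with R hR0
    have hR : 0 < R + r := add_pos_of_pos_of_nonneg hR0 (Nat.cast_nonneg r)
    rw [setAverage_eq, smul_eq_mul, hind, div_mul_eq_mul_div, div_eq_inv_mul]
    refine mul_le_mul_of_nonneg_left ?_ (inv_nonneg.2 (ballVol_pos hR0).le)
    rw [← integral_const_mul]
    refine integral_mono (hindint R) ((hint _ hR).const_mul _) fun x => ?_
    dsimp only
    rw [← mul_assoc]
    exact mul_le_mul_of_nonneg_right (indicator_le_smear hf hf1 hr hR x) (hz0 x)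

end FreeKawasaki

namespace FreeKawasaki

variable {d : ℕ} {a : E d → ℝ}

/-! ### The transition kernel -/

/-- The configurations whose particles almost surely remain locally finite up to time `t`. -/
def IsRegular (a : E d → ℝ) (t : ℝ≥0) (γ : Configuration d) : Prop :=
  ∀ n : ℕ, epairing (smear (displacementLaw a t) (tent d n)) γ ≠ ⊤

lemma norm_tent_le_one (n : ℕ) (x : E d) : ‖tent d n x‖ ≤ 1 := by
  rw [Real.norm_of_nonneg (tent_nonneg n x)]
  exact tent_le_one n x

lemma smear_nonneg (κ : Measure (E d)) {g : E d → ℝ} (hg : ∀ x, 0 ≤ g x) (x : E d) :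
    0 ≤ smear κ g x := integral_nonneg fun _ => hg _

lemma measurableSet_isRegular (ha0 : ∀ y, 0 ≤ a y) (hpos : 0 < totalRate a) (t : ℝ≥0) :
    MeasurableSet {γ : Configuration d | IsRegular a t γ} := by
  have := isProbabilityMeasure_displacementLaw ha0 hpos t
  have h : {γ : Configuration d | IsRegular a t γ} =
      ⋂ n : ℕ, (epairing (smear (displacementLaw a t) (tent d n))) ⁻¹' {⊤}ᶜ := by
    ext γ
    simp [IsRegular]
  rw [h]
  exact MeasurableSet.iInter fun n => measurable_epairing
    (continuous_smear _ (continuous_tent n) (norm_tent_le_one n))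
    (smear_nonneg _ (tent_nonneg n)) (measurableSet_singleton ⊤).compl

lemma measurable_position (x : E d) (t : ℝ≥0) :
    Measurable fun w : ParticleSpace d => position x w t :=
  measurable_const.sub (measurable_displacement t)

lemma integral_comp_position (t : ℝ≥0) (x : E d) {g : E d → ℝ} (hg : Continuous g) :
    ∫ w, g (position x w t) ∂particleLaw a = smear (displacementLaw a t) g x := by
  rw [smear, displacementLaw, integral_map (measurable_displacement t).aemeasurable]
  · rfl
  · exact (hg.comp (continuous_const.sub continuous_id)).aestronglyMeasurable

lemma particleLaw_norm_position_le (ha0 : ∀ y, 0 ≤ a y) (hpos : 0 < totalRate a) (t : ℝ≥0) (n : ℕ)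
    (x : E d) : particleLaw a {w | ‖position x w t‖ ≤ n} ≤
      ENNReal.ofReal (smear (displacementLaw a t) (tent d n) x) := by
  have := isProbabilityMeasure_particleLaw ha0 hpos
  have hm : Measurable fun w : ParticleSpace d => tent d n (position x w t) :=
    (continuous_tent n).measurable.comp (measurable_position x t)
  rw [← integral_comp_position t x (continuous_tent n), ofReal_integral_eq_lintegral_ofReal
    (Integrable.of_bound hm.aestronglyMeasurable 1 (ae_of_all _ fun _ => norm_tent_le_one _ _))
    (ae_of_all _ fun _ => tent_nonneg _ _), ← setLIntegral_one]
  refine (setLIntegral_mono' (measurableSet_le (measurable_position x t).norm measurable_const)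
    fun w hw => ?_).trans (setLIntegral_le_lintegral _ _)
  rw [tent_eq_one hw, ENNReal.ofReal_one]

/-- Borel–Cantelli: regularity of `γ` bounds the sum over the particles of the probabilities of
being in a given ball at time `t`. -/
lemma ae_finite_norm_position_le (ha0 : ∀ y, 0 ≤ a y) (hpos : 0 < totalRate a) {t : ℝ≥0}
    {γ : Configuration d} (hγ : IsRegular a t γ) :
    ∀ᵐ w ∂systemLaw a γ, ∀ n : ℕ, {x : γ.carrier | ‖position (x : E d) (w x) t‖ ≤ n}.Finite := by
  have := isProbabilityMeasure_particleLaw ha0 hpos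
  have : Countable γ.carrier := (countable_carrier γ).to_subtype
  refine ae_all_iff.2 fun n => ?_
  let A : γ.carrier → Set (γ.carrier → ParticleSpace d) :=
    fun x => {w | ‖position (x : E d) (w x) t‖ ≤ n}
  have hA : ∀ x, systemLaw a γ (A x) ≤
      ENNReal.ofReal (smear (displacementLaw a t) (tent d n) x) := fun x => by
    refine le_trans (le_of_eq ?_) (particleLaw_norm_position_le ha0 hpos t n (x : E d))
    exact (measurePreserving_eval_infinitePi (fun _ : γ.carrier => particleLaw a) x).measure_preimage
      (measurableSet_le (measurable_position (x : E d) t).norm measurable_const).nullMeasurableSet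
  have hsum : ∑' x, systemLaw a γ (A x) ≠ ⊤ :=
    ne_top_of_le_ne_top (hγ n) (ENNReal.tsum_le_tsum hA)
  exact ae_finite_setOfPred_mem hsum

/-- The position of a particle has no atom except possibly its starting point, and distinct
particles start at distinct points. A configuration is a set, so coinciding particles would be
counted once. -/
lemma ae_injective_position (hd : 0 < d) (ha0 : ∀ y, 0 ≤ a y) (hpos : 0 < totalRate a) (t : ℝ≥0)
    (γ : Configuration d) :
    ∀ᵐ w ∂systemLaw a γ, Function.Injective fun x : γ.carrier => position (x : E d) (w x) t := by
  have := isProbabilityMeasure_particleLaw ha0 hpos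
  have : Countable γ.carrier := (countable_carrier γ).to_subtype
  have hnull : ∀ x y : E d, y ≠ x →
      particleLaw a ((fun w => position x w t) ⁻¹' {y}) = 0 := by
    intro x y hxy
    refine Eq.trans ?_ (particleLaw_displacement_eq hd ha0 hpos t (sub_ne_zero.2 hxy.symm))
    congr 1
    ext w
    simp only [Set.mem_preimage, Set.mem_singleton_iff, position_eq]
    rw [sub_eq_iff_eq_add, eq_sub_iff_add_eq, add_comm y, eq_comm]
  have h : ∀ᵐ w ∂systemLaw a γ, ∀ x y : γ.carrier, x ≠ y →
      position (x : E d) (w x) t ≠ position (y : E d) (w y) t := by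
    refine ae_all_iff.2 fun x => ae_all_iff.2 fun y => ?_
    by_cases hxy : x = y
    · simp [hxy]
    · have := ae_infinitePi_ne (fun _ : γ.carrier => particleLaw a) hxy
        (measurable_position (x : E d) t) (measurable_position (y : E d) t) (y : E d)
        (hnull _ _ fun h => hxy (Subtype.ext h.symm)) fun e he => hnull _ _ he
      filter_upwards [this] with w hw _
      exact hw
  filter_upwards [h] with w hw x y hxy
  by_contra hne
  exact hw x y hne hxy

/-- Local finiteness and injectivity hold off one null set, which serves all test functions
simultaneously. -/
lemma ae_pairing_state (hd : 0 < d) (ha0 : ∀ y, 0 ≤ a y) (hpos : 0 < totalRate a) {t : ℝ≥0}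
    {γ : Configuration d} (hγ : IsRegular a t γ) :
    ∀ᵐ w ∂systemLaw a γ, ∀ f : E d → ℝ, IsTest f → ENNReal.ofReal (pairing f (state γ t w)) =
      ∑' x : γ.carrier, ENNReal.ofReal (f (position (x : E d) (w x) t)) := by
  filter_upwards [ae_finite_norm_position_le ha0 hpos hγ, ae_injective_position hd ha0 hpos t γ]
    with w hw hinj f hf
  have hfin : ∀ n : ℕ, {x ∈ (Set.univ : Set γ.carrier) | ‖position (x : E d) (w x) t‖ ≤ n}.Finite :=
    fun n => by simpa using hw n
  rw [ofReal_pairing hf.compact hf.nonneg, state, ← Set.image_univ, epairing,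
    carrier_ofSet_image hfin, tsum_image (fun y => ENNReal.ofReal (f y)) hinj.injOn,
    tsum_univ fun x : γ.carrier => ENNReal.ofReal (f (position (x : E d) (w x) t))]

lemma aemeasurable_state (hd : 0 < d) (ha0 : ∀ y, 0 ≤ a y) (hpos : 0 < totalRate a) {t : ℝ≥0}
    {γ : Configuration d} (hγ : IsRegular a t γ) : AEMeasurable (state γ t) (systemLaw a γ) := by
  have : Countable γ.carrier := (countable_carrier γ).to_subtype
  refine aemeasurable_of_pairing fun f hf => ?_
  have hm : Measurable fun w : γ.carrier → ParticleSpace d =>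
      (∑' x : γ.carrier, ENNReal.ofReal (f (position (x : E d) (w x) t))).toReal := by
    refine (Measurable.tsum fun x => ?_).ennreal_toReal
    exact (hf.continuous.measurable.comp
      ((measurable_position (x : E d) t).comp (measurable_pi_apply x))).ennreal_ofReal
  refine hm.aemeasurable.congr ?_
  filter_upwards [ae_pairing_state hd ha0 hpos hγ] with w hw
  rw [← hw f hf, ENNReal.toReal_ofReal (pairing_nonneg hf.nonneg _)]

lemma isProbabilityMeasure_transition (hd : 0 < d) (ha0 : ∀ y, 0 ≤ a y) (hpos : 0 < totalRate a)
    {t : ℝ≥0} {γ : Configuration d} (hγ : IsRegular a t γ) :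
    IsProbabilityMeasure (transition a t γ) := by
  have := isProbabilityMeasure_particleLaw ha0 hpos
  have : IsProbabilityMeasure (systemLaw a γ) := by
    unfold systemLaw
    infer_instance
  exact Measure.isProbabilityMeasure_map (aemeasurable_state hd ha0 hpos hγ)

/-- The logarithm `u` of the Laplace transform of `f` under the motion of one particle. -/
noncomputable def logLaplace (κ : Measure (E d)) (f : E d → ℝ) (x : E d) : ℝ :=
  -Real.log (smear κ (fun y => Real.exp (-f y)) x)

/-- The function `1 - e^{-f}`. -/
noncomputable def oneSubExpNeg (f : E d → ℝ) (x : E d) : ℝ := 1 - Real.exp (-f x)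

lemma isTest_oneSubExpNeg {f : E d → ℝ} (hf : IsTest f) : IsTest (oneSubExpNeg f) :=
  ⟨contDiff_const.sub hf.smooth.neg.exp, hf.compact.mono fun x hx h => hx (by simp [oneSubExpNeg, h]),
    fun x => one_sub_exp_neg_nonneg (hf.nonneg x)⟩

lemma norm_exp_neg_le_one {f : E d → ℝ} (hf : ∀ x, 0 ≤ f x) (x : E d) :
    ‖Real.exp (-f x)‖ ≤ 1 := by
  rw [Real.norm_of_nonneg (Real.exp_pos _).le]
  exact Real.exp_le_one_iff.2 (neg_nonpos.2 (hf x))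

/-! ### The motion of one particle seen by Laplace transforms -/

section LogLaplace

variable (κ : Measure (E d)) [IsProbabilityMeasure κ] {f : E d → ℝ}

lemma smear_exp_neg_pos (hf : IsTest f) (x : E d) : 0 < smear κ (fun y => Real.exp (-f y)) x :=
  integral_exp_pos (integrable_comp_sub κ hf.continuous.neg.rexp (norm_exp_neg_le_one hf.nonneg) x)

/-- Smearing by a probability measure fixes constants. The identity replaces the logarithm in the
Laplace functional by an average of the compactly supported function `1 - e^{-f}`. -/
lemma one_sub_smear_exp_neg (hf : IsTest f) (x : E d) :
    1 - smear κ (fun y => Real.exp (-f y)) x = smear κ (oneSubExpNeg f) x := by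
  have h : Integrable (fun s => Real.exp (-f (x - s))) κ :=
    integrable_comp_sub κ hf.continuous.neg.rexp (norm_exp_neg_le_one hf.nonneg) x
  simp only [smear, oneSubExpNeg]
  rw [integral_sub (integrable_const _) h]
  simp

lemma exp_neg_logLaplace (hf : IsTest f) (x : E d) :
    Real.exp (-logLaplace κ f x) = smear κ (fun y => Real.exp (-f y)) x := by
  rw [logLaplace, neg_neg, Real.exp_log (smear_exp_neg_pos κ hf x)]

lemma continuous_logLaplace (hf : IsTest f) : Continuous (logLaplace κ f) :=
  ((continuous_smear κ hf.continuous.neg.rexp (norm_exp_neg_le_one hf.nonneg)).log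
    fun x => (smear_exp_neg_pos κ hf x).ne').neg

lemma logLaplace_nonneg (hf : IsTest f) (x : E d) : 0 ≤ logLaplace κ f x := by
  rw [logLaplace, neg_nonneg]
  refine Real.log_nonpos (smear_exp_neg_pos κ hf x).le ?_
  rw [← sub_nonneg, one_sub_smear_exp_neg κ hf]
  exact smear_nonneg κ (isTest_oneSubExpNeg hf).nonneg x

end LogLaplace

/-- The Laplace functional of the transition kernel. -/
theorem lintegral_transition (hd : 0 < d) (ha0 : ∀ y, 0 ≤ a y) (hpos : 0 < totalRate a) {t : ℝ≥0}
    {γ : Configuration d} (hγ : IsRegular a t γ) {f : E d → ℝ} (hf : IsTest f) :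
    ∫⁻ η, ENNReal.ofReal (Real.exp (-pairing f η)) ∂transition a t γ =
      expNeg (epairing (logLaplace (displacementLaw a t) f) γ) := by
  have := isProbabilityMeasure_particleLaw ha0 hpos
  have := isProbabilityMeasure_displacementLaw ha0 hpos t
  have : Countable γ.carrier := (countable_carrier γ).to_subtype
  have hm : ∀ x : E d, Measurable fun w : ParticleSpace d => f (position x w t) := fun x =>
    hf.continuous.measurable.comp (measurable_position x t)
  have hu : ∀ x : E d, ∫⁻ w, expNeg (ENNReal.ofReal (f (position x w t))) ∂particleLaw a =
      expNeg (ENNReal.ofReal (logLaplace (displacementLaw a t) f x)) := by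
    intro x
    have hint : Integrable (fun w => Real.exp (-f (position x w t))) (particleLaw a) :=
      Integrable.of_bound (hm x).neg.exp.aestronglyMeasurable 1
        (ae_of_all _ fun w => norm_exp_neg_le_one hf.nonneg _)
    rw [expNeg_ofReal (logLaplace_nonneg _ hf x), exp_neg_logLaplace _ hf,
      ← integral_comp_position t x (g := fun y => Real.exp (-f y)) hf.continuous.neg.rexp,
      ofReal_integral_eq_lintegral_ofReal hint
        (ae_of_all _ fun w => (Real.exp_pos _).le)]
    exact lintegral_congr fun w => expNeg_ofReal (hf.nonneg _)
  rw [transition, lintegral_map' ?_ (aemeasurable_state hd ha0 hpos hγ)]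
  -- By independence the Laplace transform factorizes over the particles, possibly infinitely many,
  -- and their logarithms add up.
  · rw [epairing, ← lintegral_infinitePi_expNeg_tsum (fun _ : γ.carrier => particleLaw a)
      (h := fun x w => ENNReal.ofReal (f (position (x : E d) w t)))
      (fun x => (hm x).ennreal_ofReal) fun x => hu x]
    refine lintegral_congr_ae ?_
    filter_upwards [ae_pairing_state hd ha0 hpos hγ] with w hw
    rw [← hw f hf, expNeg_ofReal (pairing_nonneg hf.nonneg _)]
  · exact (continuous_pairing hf.continuous hf.compact).neg.rexp.measurable.ennreal_ofReal.aemeasurable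

lemma integral_exp_neg_pairing {μ : Measure (Configuration d)} {f : E d → ℝ} (hf : IsTest f) :
    ∫ γ, Real.exp (-pairing f γ) ∂μ =
      (∫⁻ γ, ENNReal.ofReal (Real.exp (-pairing f γ)) ∂μ).toReal :=
  integral_eq_lintegral_of_nonneg_ae (ae_of_all _ fun _ => (Real.exp_pos _).le)
    (continuous_pairing hf.continuous hf.compact).neg.rexp.aestronglyMeasurable

open Classical in
/-- A measurable version of the transition kernel. -/
noncomputable def regularTransition (a : E d → ℝ) (t : ℝ≥0) (γ : Configuration d) :
    Measure (Configuration d) :=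
  if IsRegular a t γ then transition a t γ else Measure.dirac (Configuration.ofSet ∅)

lemma isProbabilityMeasure_regularTransition (hd : 0 < d) (ha0 : ∀ y, 0 ≤ a y)
    (hpos : 0 < totalRate a) (t : ℝ≥0) (γ : Configuration d) :
    IsProbabilityMeasure (regularTransition a t γ) := by
  unfold regularTransition
  split_ifs with h
  · exact isProbabilityMeasure_transition hd ha0 hpos h
  · infer_instance

/-- On the measurable set of regular configurations the Laplace functional is an explicit function
of an extended pairing, hence measurable in `γ`; off this set it is constant. -/
lemma measurable_regularTransition (hd : 0 < d) (ha0 : ∀ y, 0 ≤ a y) (hpos : 0 < totalRate a)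
    (t : ℝ≥0) : Measurable (regularTransition (d := d) a t) := by
  classical
  have := isProbabilityMeasure_displacementLaw ha0 hpos t
  refine measurable_of_measurable_laplace
    (isProbabilityMeasure_regularTransition hd ha0 hpos t) fun f hf => ?_
  have h : (fun γ => ∫ η, Real.exp (-pairing f η) ∂regularTransition a t γ) =
      fun γ => if IsRegular a t γ then
        (expNeg (epairing (logLaplace (displacementLaw a t) f) γ)).toReal
      else ∫ η, Real.exp (-pairing f η) ∂Measure.dirac (Configuration.ofSet ∅) := by
    funext γ
    unfold regularTransition
    split_ifs with hγ
    · rw [integral_exp_neg_pairing hf, lintegral_transition hd ha0 hpos hγ hf]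
    · rfl
  rw [h]
  refine Measurable.ite (measurableSet_isRegular ha0 hpos t) ?_ measurable_const
  exact (continuous_expNeg.measurable.comp (measurable_epairing (continuous_logLaplace _ hf)
    (logLaplace_nonneg _ hf))).ennreal_toReal

/-! ### Poisson initial distributions -/

section OneDim

variable {z : E d → ℝ} {M : ℝ}

/-- A smeared tent is integrable against the bounded intensity `z`, since averaging over
translations preserves integrability. Its pairing with a Poisson configuration is then almost surely
finite. -/
lemma ae_isRegular (hd : 0 < d) (ha0 : ∀ y, 0 ≤ a y) (hpos : 0 < totalRate a) (hz : Measurable z)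
    (hz0 : ∀ x, 0 ≤ z x) (hM : ∀ x, z x ≤ M) (t : ℝ≥0) :
    ∀ᵐ γ ∂poissonMeasure z, IsRegular a t γ := by
  have := isProbabilityMeasure_displacementLaw ha0 hpos t
  refine ae_all_iff.2 fun n => ?_
  refine ae_epairing_ne_top hd hz hz0 hM
    (continuous_smear _ (continuous_tent n) (norm_tent_le_one n))
    (smear_nonneg _ (tent_nonneg n)) ?_
  have hi := integrable_smear_mul (displacementLaw a t) (continuous_tent n)
    ((continuous_tent n).integrable_of_hasCompactSupport (hasCompactSupport_tent n)) hz (M := M)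
    fun x => by rw [Real.norm_of_nonneg (hz0 x)]; exact hM x
  exact hi.lintegral_lt_top.ne

lemma transition_ae_eq (hd : 0 < d) (ha0 : ∀ y, 0 ≤ a y) (hpos : 0 < totalRate a)
    (hz : Measurable z) (hz0 : ∀ x, 0 ≤ z x) (hM : ∀ x, z x ≤ M) (t : ℝ≥0) :
    transition a t =ᵐ[poissonMeasure z] regularTransition a t := by
  filter_upwards [ae_isRegular hd ha0 hpos hz hz0 hM t] with γ hγ
  rw [regularTransition, if_pos hγ]

/-- This gives `Measure.bind` its intended meaning: the integral of the kernel against the Poisson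
measure. -/
lemma aemeasurable_transition (hd : 0 < d) (ha0 : ∀ y, 0 ≤ a y) (hpos : 0 < totalRate a)
    (hz : Measurable z) (hz0 : ∀ x, 0 ≤ z x) (hM : ∀ x, z x ≤ M) (t : ℝ≥0) :
    AEMeasurable (transition a t) (poissonMeasure z) :=
  ⟨_, measurable_regularTransition hd ha0 hpos t, transition_ae_eq hd ha0 hpos hz hz0 hM t⟩

lemma isProbabilityMeasure_oneDimDistribution (hd : 0 < d) (ha0 : ∀ y, 0 ≤ a y)
    (hpos : 0 < totalRate a) (hz : Measurable z) (hz0 : ∀ x, 0 ≤ z x) (hM : ∀ x, z x ≤ M)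
    (t : ℝ≥0) : IsProbabilityMeasure (oneDimDistribution a (poissonMeasure z) t) := by
  have := (isPoissonMeasure_poissonMeasure hd hz hz0 hM).1
  refine ⟨?_⟩
  rw [oneDimDistribution, Measure.bind_apply MeasurableSet.univ
    (aemeasurable_transition hd ha0 hpos hz hz0 hM t)]
  have h : ∀ᵐ γ ∂poissonMeasure z, transition a t γ Set.univ = 1 := by
    filter_upwards [ae_isRegular hd ha0 hpos hz hz0 hM t] with γ hγ
    exact (isProbabilityMeasure_transition hd ha0 hpos hγ).measure_univ
  rw [lintegral_congr_ae h]
  simp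

/-- The Laplace functional of the one-dimensional distributions. -/
theorem integral_oneDimDistribution (hd : 0 < d) (ha0 : ∀ y, 0 ≤ a y)
    (hpos : 0 < totalRate a) (hz : Measurable z) (hz0 : ∀ x, 0 ≤ z x) (hM : ∀ x, z x ≤ M)
    (t : ℝ≥0) {f : E d → ℝ} (hf : IsTest f) :
    ∫ γ, Real.exp (-pairing f γ) ∂oneDimDistribution a (poissonMeasure z) t =
      Real.exp (-∫ x, smear (displacementLaw a t) (oneSubExpNeg f) x * z x) := by
  have := isProbabilityMeasure_displacementLaw ha0 hpos t
  have hg := isTest_oneSubExpNeg hf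
  have h0 : ∀ x, 0 ≤ smear (displacementLaw a t) (oneSubExpNeg f) x * z x := fun x =>
    mul_nonneg (smear_nonneg _ hg.nonneg x) (hz0 x)
  have hi := integrable_smear_mul (displacementLaw a t) hg.continuous
    (hg.continuous.integrable_of_hasCompactSupport hg.compact) hz (M := M)
    fun x => by rw [Real.norm_of_nonneg (hz0 x)]; exact hM x
  have h1 : ∀ᵐ γ ∂poissonMeasure z,
      ∫⁻ η, ENNReal.ofReal (Real.exp (-pairing f η)) ∂transition a t γ =
        expNeg (epairing (logLaplace (displacementLaw a t) f) γ) := by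
    filter_upwards [ae_isRegular hd ha0 hpos hz hz0 hM t] with γ hγ
    exact lintegral_transition hd ha0 hpos hγ hf
  have hm : Measurable fun γ : Configuration d => ENNReal.ofReal (Real.exp (-pairing f γ)) :=
    (continuous_pairing hf.continuous hf.compact).neg.rexp.measurable.ennreal_ofReal
  rw [integral_exp_neg_pairing hf, oneDimDistribution, Measure.lintegral_bind
    (aemeasurable_transition hd ha0 hpos hz hz0 hM t) hm.aemeasurable,
    lintegral_congr_ae h1, lintegral_expNeg_epairing hd hz hz0 hM (continuous_logLaplace _ hf)
      (logLaplace_nonneg _ hf)]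
  -- The Poisson exponent `1 - e^{-u}`, with `u` the logarithmic transform, is the smeared `1 -
  -- e^{-f}`, so the exponent becomes an average of `z` of the kind treated above.
  simp only [exp_neg_logLaplace _ hf, one_sub_smear_exp_neg _ hf]
  rw [← ofReal_integral_eq_lintegral_ofReal hi (ae_of_all _ h0), expNeg_ofReal (integral_nonneg h0),
    ENNReal.toReal_ofReal (Real.exp_pos _).le]

end OneDim

lemma HasArithmeticMean.nonneg {z : E d → ℝ} (hz0 : ∀ x, 0 ≤ z x) {m : ℝ}
    (h : HasArithmeticMean z m) : 0 ≤ m :=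
  ge_of_tendsto' h fun R => by
    rw [setAverage_eq]
    exact mul_nonneg (inv_nonneg.2 measureReal_nonneg) (integral_nonneg hz0)

end FreeKawasaki

/-! ### Conclusion -/

theorem mainTheorem4 (d : ℕ) (hd : 0 < d)
    (a : FreeKawasaki.E d → ℝ) (ha_meas : Measurable a) (ha_nonneg : ∀ y, 0 ≤ a y)
    (ha_pos : 0 < FreeKawasaki.totalRate a)
    (ha_decay : ∃ α C : ℝ, 2 * (d : ℝ) < α ∧ ∀ y, a y ≤ C / (1 + ‖y‖) ^ α)
    (z : FreeKawasaki.E d → ℝ) (hz_meas : Measurable z) (hz_nonneg : ∀ x, 0 ≤ z x)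
    (hz_bdd : ∃ M : ℝ, ∀ x, z x ≤ M)
    (hz_fourier : FreeKawasaki.FourierTransformIsMeasure z) :
    ∃ m : ℝ, FreeKawasaki.HasArithmeticMean z m ∧
      FreeKawasaki.IsPoissonMeasure z (FreeKawasaki.poissonMeasure z) ∧
      FreeKawasaki.IsPoissonMeasure (fun _ : FreeKawasaki.E d => m)
        (FreeKawasaki.poissonMeasure fun _ : FreeKawasaki.E d => m) ∧
      ∃ (hP : ∀ t : ℝ≥0, IsProbabilityMeasure
            (FreeKawasaki.oneDimDistribution a (FreeKawasaki.poissonMeasure z) t))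
        (hm : IsProbabilityMeasure
            (FreeKawasaki.poissonMeasure fun _ : FreeKawasaki.E d => m)),
        Tendsto (β := ProbabilityMeasure (FreeKawasaki.Configuration d))
          (fun t : ℝ≥0 => ⟨FreeKawasaki.oneDimDistribution a (FreeKawasaki.poissonMeasure z) t,
            hP t⟩)
          atTop
          (𝓝 ⟨FreeKawasaki.poissonMeasure fun _ : FreeKawasaki.E d => m, hm⟩) := by
  open FreeKawasaki in
  obtain ⟨M, hM⟩ := hz_bdd
  have hzM : ∀ x, ‖z x‖ ≤ M := fun x => by
    rw [Real.norm_of_nonneg (hz_nonneg x)]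
    exact hM x
  obtain ⟨m, hlim⟩ := FourierTransformIsMeasure.exists_tendsto hz_meas hzM hz_fourier
  have hmean : HasArithmeticMean z m := by
    refine hasArithmeticMean_of_tendsto hz_meas hz_nonneg hM fun f hf => ?_
    -- The radius is kept positive so that `ballLaw` is a probability measure for every index `R`.
    have hmax : Tendsto (fun R : ℝ => max R 1) atTop atTop :=
      tendsto_atTop_mono (fun R => le_max_left R 1) tendsto_id
    have h := hlim ℝ atTop (fun R => ballLaw d (max R 1))
      (fun R => isProbabilityMeasure_ballLaw (lt_max_of_lt_right one_pos))
      (fun k hk => (tendsto_charFun_ballLaw hk).comp hmax) f hf.smooth hf.compact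
    refine h.congr' ?_
    filter_upwards [eventually_ge_atTop 1] with R hR
    rw [max_eq_left hR]
  have hm0 : 0 ≤ m := HasArithmeticMean.nonneg hz_nonneg hmean
  have hPm := isPoissonMeasure_poissonMeasure (z := fun _ : E d => m) hd measurable_const
    (fun _ => hm0) (fun _ => le_rfl)
  refine ⟨m, hmean, isPoissonMeasure_poissonMeasure hd hz_meas hz_nonneg hM, hPm,
    isProbabilityMeasure_oneDimDistribution hd ha_nonneg ha_pos hz_meas hz_nonneg hM, hPm.1,
    tendsto_of_tendsto_laplace fun f hf => ?_⟩
  have hg := isTest_oneSubExpNeg hf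
  -- The constant `m` does not depend on the averaging measures, so the limit along displacement
  -- laws carries the arithmetic mean found with balls.
  have h := hlim ℝ≥0 atTop (displacementLaw a)
    (isProbabilityMeasure_displacementLaw ha_nonneg ha_pos)
    (fun k hk => tendsto_charFun_displacementLaw ha_nonneg ha_pos hk) _ hg.smooth hg.compact
  have hlimit : ∫ γ, Real.exp (-pairing f γ) ∂poissonMeasure (fun _ : E d => m) =
      Real.exp (-(m * ∫ x, oneSubExpNeg f x)) := by
    have hneg : ∀ γ, -pairing f γ = pairing (-f) γ := fun γ => tsum_neg.symm
    simp only [hneg]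
    rw [hPm.2 (-f) hf.smooth.neg hf.compact.neg, integral_mul_const, mul_comm, ← mul_neg,
      ← integral_neg]
    simp [oneSubExpNeg]
  simp only [ProbabilityMeasure.coe_mk,
    integral_oneDimDistribution hd ha_nonneg ha_pos hz_meas hz_nonneg hM _ hf, hlimit]
  exact (Real.continuous_exp.tendsto _).comp h.neg
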